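/- **Setting.** Identify $\mathbb{R}^4$ with the quaternions $\mathbb{H}$, with canonical basis $e_0=1,e_1=i,e_2=j,e_3=k$, let $S^3\subset\mathbb{H}$ be the group of unit quaternions and $o=1$. Orient $T_pS^3=p^\perp$ by declaring $(u,v,w)$ positive if $\det(p,u,v,w)>0$. Let $SO(S^3)$ be the bundle over $S^3$ of all direct linear isometries $b:T_oS^3\to T_pS^3$, $p\in S^3$. The bijection $g\mapsto (dg)_o$ identifies it with $SO_4$, and $SO(S^3)$ carries the pseudo-Riemannian metric of signature $(3,3)$ corresponding to the left invariant one on $SO_4$ given on $\mathfrak{so}(4)$ by $$\langle Z(x,\xi),Z(y,\eta)\rangle=\tfrac14\big(\langle x,\eta\rangle+\langle y,\xi\rangle\big),\qquad Z(x,\xi)=\begin{pmatrix}0&-x^T\\ x&C_\xi\end{pmatrix},\quad C_\xi(y)=\xi\times y,\quad x,\xi,y,\eta\in\mathbb{R}^3 .$$ **Definition.** Let $N$ be a pseudo-Riemannian manifold of signature $(m,m)$. A submanifold is *space-like* if the metric is positive definite on its tangent spaces. An oriented space-like $m$-dimensional submanifold $M$ of $N$ is *homologically volume maximizing* if for every open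 subset $U$ of $M$ with compact closure in $M$ and smooth border $\partial U$ one has $\operatorname{vol}_m(U)\ge \operatorname{vol}_m(V)$ for every oriented space-like $m$-dimensional embedded submanifold $V$ of $N$ with compact closure in $N$, $\partial V=\partial U$ (where $\partial V=\overline V\setminus V$, and likewise for $U$), and finite $m$-dimensional area (with respect to a Riemannian metric; automatic if $\overline V$ is a compact submanifold with boundary $\partial V$), that is homologous to $U$ and coherently oriented. Here *homologous* means that $V-U$ is the boundary of a smooth singular $(m+1)$-chain $c$ of $N$ with real coefficients (for instance, integral ones), in the sense that $\int_V\varphi-\int_U\varphi=\int_{\partial c}\varphi$ for all smooth $m$-forms $\varphi$ on $N$, with $U$ oriented as $M$; and *coherently oriented* means that any two positively oriented frames tangent to $V$, at the same or at different points, can be joined by a continuous path of $m$-frames of $N$ spanning space-like subspaces (this is automatic if $V$ is connected). **Theorem.** The section $b$ of $SO(S^3)\to S^3$ given by $b(p)=(dL_p)_1$, where $L_p$ is left multiplication by $p$, is smooth, and its image $b(S^3)$, oriented so that $b:S^3\to b(S^3)$ preserves orientation, is a space-like smooth submanifold of $SO(S^3)$ that is homologically volume maximizing. -/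

import Mathlib

open scoped ContDiff MeasureTheory RealInnerProductSpace

noncomputable section

/-! ### Oriented submanifolds of a Euclidean space -/

section General

variable {E : Type*} [NormedAddCommGroup E] [InnerProductSpace ℝ E]

/-- `V` is an embedded smooth `m`-dimensional submanifold (without boundary points) of `E`: near each
of its points it is the homeomorphic image of an open subset of `ℝᵐ` under a smooth immersion. -/
def IsSmoothSubmanifold (m : ℕ) (V : Set E) : Prop :=
  ∀ x ∈ V, ∃ (O : Set E) (W : Set (EuclideanSpace ℝ (Fin m))) (φ : EuclideanSpace ℝ (Fin m) → E),
    IsOpen O ∧ x ∈ O ∧ IsOpen W ∧ ContDiffOn ℝ ∞ φ W ∧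
    (∀ w ∈ W, Function.Injective (fderiv ℝ φ w)) ∧
    Topology.IsEmbedding (W.domRestrict φ) ∧ φ '' W = V ∩ O

/-- The tangent space at `x` of a subset `V` of `E`. If `V` is a submanifold and `x ∈ V`, the
tangent cone is already a linear space, the usual tangent space. -/
def tangentSpaceAt (V : Set E) (x : E) : Submodule ℝ E :=
  Submodule.span ℝ (tangentConeAt ℝ V x)

/-- `V` is a smooth `m`-dimensional submanifold of `E` and the continuous field `η` of alternating
forms restricts to a nonzero `m`-form on each tangent space of `V`, and so orients `V`: the frames
`v` of `T_x V` with `η x v > 0` are the positive ones. -/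
structure IsOrientedSubmanifold (m : ℕ) (V : Set E) (η : E → E [⋀^Fin m]→ₗ[ℝ] ℝ) : Prop where
  smooth : IsSmoothSubmanifold m V
  continuous_form : ∀ v : Fin m → E, ContinuousOn (fun x => η x v) V
  ne_zero : ∀ x ∈ V, ∃ v : Fin m → E, (∀ i, v i ∈ tangentSpaceAt V x) ∧ η x v ≠ 0

/-- `v` is a positively oriented frame of `T_x V`. -/
def IsPositiveFrame {m : ℕ} (V : Set E) (η : E → E [⋀^Fin m]→ₗ[ℝ] ℝ) (x : E) (v : Fin m → E) :
    Prop :=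
  (∀ i, v i ∈ tangentSpaceAt V x) ∧ 0 < η x v

/-- Some positively oriented frame of `T_x V` that is orthonormal for the Euclidean inner product
of `E`. What follows does not depend on which one. -/
def orthonormalFrame {m : ℕ} (V : Set E) (η : E → E [⋀^Fin m]→ₗ[ℝ] ℝ) (x : E) : Fin m → E :=
  Classical.epsilon fun e => Orthonormal ℝ e ∧ IsPositiveFrame V η x e

/-- The Gram matrix of `v` for the inner product `g x`. -/
def gramMatrix {m : ℕ} (g : E → E → E → ℝ) (x : E) (v : Fin m → E) : Matrix (Fin m) (Fin m) ℝ :=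
  Matrix.of fun i j => g x (v i) (v j)

/-- The subset `V` is space-like for `g`: `g` is positive definite on its tangent spaces. -/
def IsSpacelike (g : E → E → E → ℝ) (V : Set E) : Prop :=
  ∀ x ∈ V, ∀ v ∈ tangentSpaceAt V x, v ≠ 0 → 0 < g x v v

/-- The `m`-frames tangent to `N` (with their base points) that span space-like subspaces. -/
def spacelikeFrames (m : ℕ) (N : Set E) (g : E → E → E → ℝ) : Set (E × (Fin m → E)) :=
  {z | z.1 ∈ N ∧ (∀ i, z.2 i ∈ tangentSpaceAt N z.1) ∧ (gramMatrix g z.1 z.2).PosDef}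

/-- The orientations of the components of `V` agree, in the sense that any two positively oriented
frames tangent to `V` can be deformed into each other through space-like frames of `N`.
For space-like `V` this is automatic if `V` is connected. -/
def IsCoherentlyOriented {m : ℕ} (N : Set E) (g : E → E → E → ℝ) (V : Set E)
    (η : E → E [⋀^Fin m]→ₗ[ℝ] ℝ) : Prop :=
  ∀ x ∈ V, ∀ y ∈ V, ∀ u v : Fin m → E, IsPositiveFrame V η x u → IsPositiveFrame V η y v →
    JoinedIn (spacelikeFrames m N g) (x, u) (y, v)

/-! ### Volume, integrals of forms, homology -/

/-- The integral of the `k`-form `φ` over the smooth singular cube `c : [0,1]ᵏ → E`. -/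
def cubeIntegral {k : ℕ} (φ : E → E [⋀^Fin k]→L[ℝ] ℝ) (c : (Fin k → ℝ) → E) : ℝ :=
  ∫ t in Set.Icc (0 : Fin k → ℝ) 1, φ (c t) (fun i => fderiv ℝ c t (Pi.single i 1))

/-- The integral of the `k`-form `φ` over the boundary chain
`∑ᵢ (-1)ⁱ (c|_{tᵢ = 1} - c|_{tᵢ = 0})`, `i = 0, …, k`, of the singular cube `c : [0,1]ᵏ⁺¹ → E`. -/
def cubeBoundaryIntegral {k : ℕ} (φ : E → E [⋀^Fin k]→L[ℝ] ℝ) (c : (Fin (k + 1) → ℝ) → E) : ℝ :=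
  ∑ i : Fin (k + 1), (-1) ^ (i : ℕ) *
    (cubeIntegral φ (fun t => c (Fin.insertNth (α := fun _ => ℝ) i 1 t)) -
      cubeIntegral φ (fun t => c (Fin.insertNth (α := fun _ => ℝ) i 0 t)))

variable [MeasurableSpace E] [BorelSpace E]

/-- The `m`-dimensional volume of the space-like submanifold `V` for the metric `g`. Here `μHE[m]`
is, on `V`, the volume measure of the metric induced from `E`; the volume density of `g` with
respect to it is the root of the Gram determinant of an orthonormal frame. -/
def gVolume {m : ℕ} (g : E → E → E → ℝ) (V : Set E) (η : E → E [⋀^Fin m]→ₗ[ℝ] ℝ) : ENNReal :=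
  ∫⁻ x in V, ENNReal.ofReal (√ (gramMatrix g x (orthonormalFrame V η x)).det) ∂μHE[m]

/-- The integral of the `m`-form `φ` over the oriented submanifold `V`. -/
def formIntegral {m : ℕ} (V : Set E) (η : E → E [⋀^Fin m]→ₗ[ℝ] ℝ) (φ : E → E [⋀^Fin m]→L[ℝ] ℝ) :
    ℝ :=
  ∫ x in V, φ x (orthonormalFrame V η x) ∂μHE[m]

/-- The oriented submanifolds `V` and `U` of `N` are homologous in `N`: `V - U` is the boundary of a
smooth singular `(m+1)`-chain `∑ⱼ aⱼ cⱼ` of `N` with real coefficients (in particular, possibly with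
integral ones), as a chain against which smooth `m`-forms are integrated. -/
def AreHomologous {m : ℕ} (N V : Set E) (ηV : E → E [⋀^Fin m]→ₗ[ℝ] ℝ)
    (U : Set E) (ηU : E → E [⋀^Fin m]→ₗ[ℝ] ℝ) : Prop :=
  ∃ (n : ℕ) (a : Fin n → ℝ) (c : Fin n → (Fin (m + 1) → ℝ) → E),
    (∀ j, ContDiff ℝ ∞ (c j) ∧ ∀ t ∈ Set.Icc (0 : Fin (m + 1) → ℝ) 1, c j t ∈ N) ∧
    ∀ φ : E → E [⋀^Fin m]→L[ℝ] ℝ, ContDiff ℝ ∞ φ →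
      formIntegral V ηV φ - formIntegral U ηU φ = ∑ j, a j * cubeBoundaryIntegral φ (c j)

/-- The space-like `m`-dimensional submanifold `M` of `N`, oriented by `η`, is homologically volume
maximizing in `N` for the metric `g`: every open subset `U` of `M` with compact closure in `M` and
smooth border has at least the volume of each space-like `m`-dimensional submanifold `V` of `N` with
compact closure in `N` and the same border that is homologous to `U`. Here `V` is oriented, the
orientations of its components agree, and it has finite area, so that forms can be
integrated over it; no regularity of `V` at its border is required. -/
def HomologicallyVolumeMaximizing {m : ℕ} (N : Set E) (g : E → E → E → ℝ) (M : Set E)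
    (η : E → E [⋀^Fin m]→ₗ[ℝ] ℝ) : Prop :=
  ∀ U : Set E, (∃ O : Set E, IsOpen O ∧ U = M ∩ O) → IsCompact (closure U) → closure U ⊆ M →
    IsSmoothSubmanifold (m - 1) (closure U \ U) →
    ∀ (V : Set E) (ηV : E → E [⋀^Fin m]→ₗ[ℝ] ℝ),
      IsOrientedSubmanifold m V ηV → IsSpacelike g V → IsCoherentlyOriented N g V ηV →
      IsCompact (closure V) → closure V ⊆ N → μHE[m] V < ⊤ →
      closure V \ V = closure U \ U → AreHomologous N V ηV U η →
      gVolume g V ηV ≤ gVolume g U η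

end General

/-! ### The frame bundle of the three-sphere -/

/-- `ℝ⁴`, with canonical basis `e₀, e₁, e₂, e₃`; it is identified with the quaternions by
`e₀, e₁, e₂, e₃ ↔ 1, i, j, k`. -/
abbrev R4 : Type := EuclideanSpace ℝ (Fin 4)

/-- The vector `eᵢ` of the canonical basis. -/
abbrev e4 (i : Fin 4) : R4 := EuclideanSpace.single i 1

/-- Multiplication of quaternions. -/
def quatMul (p x : R4) : R4 :=
  Quaternion.linearIsometryEquivTuple
    (Quaternion.linearIsometryEquivTuple.symm p * Quaternion.linearIsometryEquivTuple.symm x)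

/-- The unit sphere of `ℝ⁴`, the group of unit quaternions. -/
abbrev S3 : Set R4 := Metric.sphere 0 1

/-- The space `(ℝ⁴)⁴`. The point `(p, u₁, u₂, u₃)` encodes the pair of `p` and the linear map `b`
from `T_o S³ = e₀^⊥`, where `o = e₀`, to `ℝ⁴` with `b e₁ = u₁`, `b e₂ = u₂`, `b e₃ = u₃`. -/
abbrev FrameSpace : Type := PiLp 2 fun _ : Fin 4 => R4

/-- The bundle `SO(S³)`, of all direct linear isometries `b : T_o S³ → T_p S³` with `p ∈ S³`: `b` is
such a map if and only if `(b e₁, b e₂, b e₃)` is an orthonormal basis of `T_p S³ = p^⊥` such that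
`(p, b e₁, b e₂, b e₃)` is a positively oriented basis of `ℝ⁴`. -/
def SOS3 : Set FrameSpace :=
  {F | Orthonormal ℝ (fun i => F i) ∧ 0 < (Matrix.of fun i j => F i j).det}

/-- The matrix `Z(x, ξ)` with block rows `(0, -xᵀ)` and `(x, C_ξ)`, where `C_ξ y = ξ × y`. -/
def zMatrix (x ξ : Fin 3 → ℝ) : Matrix (Fin 4) (Fin 4) ℝ :=
  !![0, -x 0, -x 1, -x 2;
    x 0, 0, -ξ 2, ξ 1;
    x 1, ξ 2, 0, -ξ 0;
    x 2, -ξ 1, ξ 0, 0]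

/-- The part `x` of `Z(x, ξ)`. -/
def xPart (A : Matrix (Fin 4) (Fin 4) ℝ) : Fin 3 → ℝ := ![A 1 0, A 2 0, A 3 0]

/-- The part `ξ` of `Z(x, ξ)`. -/
def ξPart (A : Matrix (Fin 4) (Fin 4) ℝ) : Fin 3 → ℝ := ![A 3 2, A 1 3, A 2 1]

theorem zMatrix_xPart_ξPart (A : Matrix (Fin 4) (Fin 4) ℝ) (hA : A.transpose = -A) :
    zMatrix (xPart A) (ξPart A) = A := by
  have h : ∀ i j, A j i = -A i j := fun i j => congrFun (congrFun hA i) j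
  ext i j
  fin_cases i <;> fin_cases j <;> simp [zMatrix, xPart, ξPart] <;>
    first
      | linarith [h 0 0, h 1 1, h 2 2, h 3 3]
      | linarith [h 0 1, h 0 2, h 0 3, h 1 2, h 1 3, h 2 3]

/-- The inner product of `so(4)`,
`⟨Z(x, ξ), Z(y, η)⟩ = (⟨x, η⟩ + ⟨y, ξ⟩) / 4`, of signature `(3, 3)`. -/
def so4Inner (A B : Matrix (Fin 4) (Fin 4) ℝ) : ℝ :=
  1 / 4 * (xPart A ⬝ᵥ ξPart B + xPart B ⬝ᵥ ξPart A)

/-- The group `SO₄` of direct isometries of `S³` is identified with `SO(S³)` by `g ↦ (dg)_o`, that is,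
by sending `g` to its columns `(g e₀, g e₁, g e₂, g e₃)`. For a frame `F`, the image of `g`, and a
tangent vector `X` at `F`, this is the element `g⁻¹ X = gᵀ X` of `so(4)`. -/
def leftTrivialization (F X : FrameSpace) : Matrix (Fin 4) (Fin 4) ℝ :=
  Matrix.of fun i j => ⟪F i, X j⟫

/-- The pseudo-Riemannian metric of `SO(S³)`, corresponding to the left invariant one of `SO₄` that
is `so4Inner` at the identity. -/
def splitMetric (F X Y : FrameSpace) : ℝ :=
  so4Inner (leftTrivialization F X) (leftTrivialization F Y)

/-- The section `b` of `SO(S³) → S³`, `b(p) = (dL_p)₁`, with `L_p` the left multiplication by `p`. -/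
def leftSection (p : R4) : FrameSpace :=
  WithLp.toLp 2 fun i => if i = 0 then p else fderiv ℝ (fun x => quatMul p x) (e4 0) (e4 i)

/-- The orientation of the image of a section of `SO(S³) → S³` that makes the projection
orientation preserving, where `(u, v, w)` is a positive basis of `T_p S³` if
`det (p, u, v, w) > 0`. -/
def sphereOrientation (F : FrameSpace) : FrameSpace [⋀^Fin 3]→ₗ[ℝ] ℝ :=
  ((EuclideanSpace.basisFun (Fin 4) ℝ).toBasis.det.curryLeft (F 0)).compLinearMap
    (PiLp.projₗ (𝕜 := ℝ) 2 (fun _ : Fin 4 => R4) 0)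

end

/-! The proof is a calibration argument. The Lie algebra so(4) is the sum of two ideals, spanned by
the `Z(x, x)` (left multiplications by imaginary quaternions) and the `Z(x, -x)` (right
multiplications). The metric is positive definite on the first, negative definite on the second, and
they are orthogonal. With suitably scaled left invariant coframes θ⁺ and θ⁻, whose components are
multiples of x + ξ and x - ξ, it reads ∑ θ⁺ᵢ² - ∑ θ⁻ᵢ² (`splitMetric_eq`). The calibration is φ =
θ⁺₁ ∧ θ⁺₂ ∧ θ⁺₃.

Three facts carry the proof. (1) φ is closed along `SOS3`: differentiating θ⁺ in a tangent direction
rotates it infinitesimally, and rotations preserve the determinant (`extDeriv_calibration_tangent`).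
By Stokes, φ has equal integrals over homologous submanifolds. (2) A space-like 3-frame has Gram
matrix AᵀA - BᵀB, with A and B the matrices of θ⁺ and θ⁻ on it, so its volume is at most |det A| =
|φ|, and φ does not vanish on it (`sqrt_det_gramMatrix_le`). (3) θ⁻ vanishes on the image of the
section, where φ is therefore the volume form (`calibration_eq_sqrt_det_gramMatrix`).

Coherent orientation makes the sign of φ constant on V, as φ cannot change sign along a path of
space-like frames (`calibration_mul_pos_of_joinedIn`). Hence vol V ≤ |∫_V φ| = |∫_U φ| ≤ vol U. -/

noncomputable section

open Filter Topology Module MeasureTheory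

/-! ### Alternating forms on orthonormal frames -/

section LinearAlgebra

variable {E : Type*} [NormedAddCommGroup E] [InnerProductSpace ℝ E]

theorem AlternatingMap.linearIndependent_of_apply_ne_zero {m : ℕ} (η : E [⋀^Fin m]→ₗ[ℝ] ℝ)
    {v : Fin m → E} (h : η v ≠ 0) : LinearIndependent ℝ v := by
  by_contra hv
  exact h (η.map_linearDependent v hv)

/-- An alternating form that is nonzero on some frame of `T` is positive on some orthonormal one. -/
theorem exists_orthonormal_apply_pos {m : ℕ} (hm : Odd m) (T : Submodule ℝ E)
    (η : E [⋀^Fin m]→ₗ[ℝ] ℝ) {v : Fin m → E} (hv : ∀ i, v i ∈ T) (h : η v ≠ 0) :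
    ∃ e : Fin m → E, Orthonormal ℝ e ∧ (∀ i, e i ∈ T) ∧ 0 < η e := by
  have hli := η.linearIndependent_of_apply_ne_zero h
  set S := Submodule.span ℝ (Set.range v) with hS
  have hST : S ≤ T := Submodule.span_le.2 (Set.range_subset_iff.2 hv)
  have : FiniteDimensional ℝ S := FiniteDimensional.span_of_finite ℝ (Set.finite_range v)
  have hfin : finrank ℝ S = m := by simpa using finrank_span_eq_card hli
  let b : OrthonormalBasis (Fin m) ℝ S := (stdOrthonormalBasis ℝ S).reindex (finCongr hfin)
  let e : Fin m → E := fun i => b i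
  have he : Orthonormal ℝ e := b.orthonormal.comp_linearIsometry S.subtypeₗᵢ
  have heT : ∀ i, e i ∈ T := fun i => hST (b i).2
  have hne : η e ≠ 0 := by
    intro h0
    apply h
    have key := AlternatingMap.eq_smul_basis_det b.toBasis (η.compLinearMap S.subtype)
    have h1 : (η.compLinearMap S.subtype) b.toBasis = η e := by
      simp [e]
    rw [h1, h0, zero_smul] at key
    have h2 := congrArg (fun α => α fun i => (⟨v i, Submodule.subset_span ⟨i, rfl⟩⟩ : S)) key
    simpa [Function.comp_def] using h2
  rcases lt_or_gt_of_ne hne with hlt | hgt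
  -- Negating every vector multiplies the value by (-1)ᵐ, which is -1 because m is odd.
  · refine ⟨fun i => -e i, ?_, fun i => T.neg_mem (heT i), ?_⟩
    · rw [orthonormal_iff_ite] at he ⊢
      simpa using he
    · have h3 := η.map_smul_univ (fun _ => (-1 : ℝ)) e
      simp only [neg_smul, one_smul, Finset.prod_const, Finset.card_univ, Fintype.card_fin,
        hm.neg_one_pow, smul_eq_mul, neg_mul, one_mul] at h3
      rw [h3]
      linarith
  · exact ⟨e, he, heT, hgt⟩

/-- The value of an alternating form of top degree is, up to sign, its value on an orthonormal frame
times the volume of the frame. -/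
theorem abs_apply_eq_mul_sqrt_det_gram {m : ℕ} (T : Submodule ℝ E) [FiniteDimensional ℝ T]
    (hT : finrank ℝ T = m) (ψ : E [⋀^Fin m]→ₗ[ℝ] ℝ) {e v : Fin m → E} (he : Orthonormal ℝ e)
    (heT : ∀ i, e i ∈ T) (hvT : ∀ i, v i ∈ T) :
    |ψ v| = |ψ e| * √(Matrix.gram ℝ v).det := by
  let e' : Fin m → T := fun i => ⟨e i, heT i⟩
  let v' : Fin m → T := fun i => ⟨v i, hvT i⟩
  have he' : Orthonormal ℝ e' := by
    rw [orthonormal_iff_ite] at he ⊢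
    exact he
  have hcard : Fintype.card (Fin m) = finrank ℝ T := by simp [hT]
  let b : OrthonormalBasis (Fin m) ℝ T :=
    OrthonormalBasis.mk he'
      (by rw [he'.linearIndependent.span_eq_top_of_card_eq_finrank' hcard])
  have hb : ∀ i, b i = e' i := fun i => by simp [b]
  have key := congrArg (fun α => α v')
    (AlternatingMap.eq_smul_basis_det b.toBasis (ψ.compLinearMap T.subtype))
  have h1 : (ψ.compLinearMap T.subtype) b.toBasis = ψ e := by
    simp only [AlternatingMap.compLinearMap_apply, OrthonormalBasis.coe_toBasis]
    congr 1
    funext i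
    simp [hb, e']
  have h2 : (ψ.compLinearMap T.subtype) v' = ψ v := rfl
  rw [h1] at key
  simp only [AlternatingMap.smul_apply, smul_eq_mul] at key
  rw [h2] at key
  have h3 : Matrix.gram ℝ v = (b.toBasis.toMatrix v').transpose * b.toBasis.toMatrix v' := by
    have := Matrix.gram_eq_conjTranspose_mul b v'
    rw [Matrix.conjTranspose_eq_transpose_of_trivial] at this
    exact this
  rw [key, h3, Matrix.det_mul, Matrix.det_transpose, Real.sqrt_mul_self_eq_abs, abs_mul,
    Basis.det_apply]

end LinearAlgebra

/-! ### Tangent spaces of submanifolds -/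

section Submanifold

variable {E : Type*} [NormedAddCommGroup E] [InnerProductSpace ℝ E]

/-- A linear condition satisfied by the derivatives of a function that is constant on `V` holds on
the tangent spaces of `V`. -/
theorem tangentSpaceAt_le_ker {F : Type*} [NormedAddCommGroup F] [NormedSpace ℝ F] {V : Set E}
    {x : E} {f : E → F} {f' : E →L[ℝ] F} (hf : HasFDerivAt f f' x) {a : F}
    (hV : ∀ y ∈ V, f y = a) (hx : x ∈ V) : tangentSpaceAt V x ≤ f'.toLinearMap.ker := by
  refine Submodule.span_le.2 fun y hy => ?_
  have h1 : HasFDerivWithinAt f f' V x := hf.hasFDerivWithinAt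
  have h2 : HasFDerivWithinAt f (0 : E →L[ℝ] F) V x :=
    (hasFDerivWithinAt_const a x V).congr hV (hV x hx)
  simpa using h1.unique_on h2 hy

theorem tangentSpaceAt_mono {V W : Set E} (h : V ⊆ W) (x : E) :
    tangentSpaceAt V x ≤ tangentSpaceAt W x :=
  Submodule.span_mono (tangentConeAt_mono h)

theorem tangentSpaceAt_inter_of_isOpen {V O : Set E} (hO : IsOpen O) {x : E} (hx : x ∈ O) :
    tangentSpaceAt (V ∩ O) x = tangentSpaceAt V x := by
  rw [tangentSpaceAt, tangentConeAt_inter_nhds (hO.mem_nhds hx), tangentSpaceAt]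

theorem range_fderiv_le_tangentSpaceAt {G : Type*} [NormedAddCommGroup G] [NormedSpace ℝ G]
    {W : Set G} (hW : IsOpen W) {w : G} (hw : w ∈ W) {φ : G → E} {φ' : G →L[ℝ] E}
    (hφ : HasFDerivAt φ φ' w) {V : Set E} (hV : Set.MapsTo φ W V) :
    φ'.toLinearMap.range ≤ tangentSpaceAt V (φ w) := by
  rintro _ ⟨u, rfl⟩
  refine Submodule.subset_span (tangentConeAt_mono hV.image_subset ?_)
  refine (hφ.hasFDerivWithinAt (s := W)).mapsTo_tangent_cone ?_
  rw [tangentConeAt_of_mem_nhds (hW.mem_nhds hw)]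
  trivial

/-- The tangent cone of the image of an immersion that is an embedding is contained in the image of
the derivative. -/
theorem tangentSpaceAt_le_range_fderiv {G : Type*} [NormedAddCommGroup G] [NormedSpace ℝ G]
    [FiniteDimensional ℝ G] {W : Set G} {w : G} (hw : w ∈ W) {φ : G → E}
    {φ' : G →L[ℝ] E} (hφ : HasStrictFDerivAt φ φ' w) (hinj : Function.Injective φ')
    (hemb : Topology.IsEmbedding (W.domRestrict φ)) {V O : Set E} (hO : IsOpen O)
    (hV : φ '' W = V ∩ O) : tangentSpaceAt V (φ w) ≤ φ'.toLinearMap.range := by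
  have hxO : φ w ∈ O := (hV.subset ⟨w, hw, rfl⟩).2
  rw [← tangentSpaceAt_inter_of_isOpen hO hxO, ← hV]
  have : CompleteSpace G := FiniteDimensional.complete ℝ G
  -- A left inverse A of φ' makes A ∘ φ locally invertible at w, with local inverse ψ. Then φ ∘ ψ ∘
  -- A has derivative φ' ∘ A and fixes the points of the image near φ w, so on the tangent cone φ' ∘
  -- A agrees with the identity.
  obtain ⟨A, hA⟩ : ∃ A : E →L[ℝ] G, A ∘L φ' = ContinuousLinearMap.id ℝ G := by
    let R := φ'.toLinearMap.range
    let ee : G ≃ₗ[ℝ] R := LinearEquiv.ofInjective φ'.toLinearMap hinj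
    have : FiniteDimensional ℝ R := inferInstance
    refine ⟨(LinearMap.toContinuousLinearMap ee.symm.toLinearMap) ∘L R.orthogonalProjectionOnto, ?_⟩
    ext u
    have : R.orthogonalProjectionOnto (φ' u) = ee u := by
      have h1 : φ' u = ((ee u : R) : E) := rfl
      rw [h1, Submodule.orthogonalProjectionOnto_mem_subspace_eq_self]
    simp [this]
  have hAφ : HasStrictFDerivAt (fun u => A (φ u))
      ((ContinuousLinearEquiv.refl ℝ G : G ≃L[ℝ] G) : G →L[ℝ] G) w := by
    have := A.hasStrictFDerivAt (x := φ w) |>.comp w hφ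
    rw [hA] at this
    exact this
  set ψ := hAφ.localInverse _ _ _ with hψ
  have hψd : HasStrictFDerivAt ψ
      (((ContinuousLinearEquiv.refl ℝ G : G ≃L[ℝ] G).symm : G ≃L[ℝ] G) : G →L[ℝ] G) (A (φ w)) :=
    hAφ.to_localInverse
  have hψl : ∀ᶠ u in 𝓝 w, ψ (A (φ u)) = u := hAφ.eventually_left_inverse
  have hcomp : HasFDerivAt (fun y => φ (ψ (A y))) (φ' ∘L A) (φ w) := by
    have hw' : ψ (A (φ w)) = w := hψl.self_of_nhds
    have h1 : HasFDerivAt ψ (ContinuousLinearMap.id ℝ G) (A (φ w)) := hψd.hasFDerivAt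
    have h2 := h1.comp (φ w) A.hasFDerivAt
    have h3 : HasFDerivAt φ φ' ((ψ ∘ A) (φ w)) := by
      simpa [hw'] using hφ.hasFDerivAt
    have h4 := h3.comp (φ w) h2
    simpa [Function.comp_def] using h4
  -- Here the embedding hypothesis enters: points of the image close to φ w have parameters close to
  -- w, where ψ inverts A ∘ φ.
  have hev : (fun y => y) =ᶠ[𝓝[φ '' W] (φ w)] fun y => φ (ψ (A y)) := by
    have hind : 𝓝 (⟨w, hw⟩ : W) = comap (W.domRestrict φ) (𝓝 (φ w)) :=
      hemb.nhds_eq_comap ⟨w, hw⟩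
    have h1 : ∀ᶠ u : W in 𝓝 (⟨w, hw⟩ : W), ψ (A (φ u)) = u :=
      (continuous_subtype_val.tendsto (⟨w, hw⟩ : W)).eventually hψl
    rw [hind, eventually_comap] at h1
    filter_upwards [nhdsWithin_le_nhds h1, self_mem_nhdsWithin] with y hy hyW
    obtain ⟨u, hu, rfl⟩ := hyW
    rw [hy ⟨u, hu⟩ rfl]
  refine Submodule.span_le.2 fun y hy => ?_
  have hid : HasFDerivWithinAt (fun y : E => y) (ContinuousLinearMap.id ℝ E) (φ '' W) (φ w) :=
    hasFDerivWithinAt_id _ _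
  have hid' : HasFDerivWithinAt (fun y : E => y) (φ' ∘L A) (φ '' W) (φ w) :=
    hcomp.hasFDerivWithinAt.congr_of_eventuallyEq hev (hev.self_of_nhdsWithin ⟨w, hw, rfl⟩)
  have := hid.unique_on hid' hy
  exact ⟨A y, this.symm⟩

theorem orthonormalFrame_spec {m : ℕ} (hm : Odd m) {V : Set E} {η : E → E [⋀^Fin m]→ₗ[ℝ] ℝ}
    {x : E} (h : ∃ v : Fin m → E, (∀ i, v i ∈ tangentSpaceAt V x) ∧ η x v ≠ 0) :
    Orthonormal ℝ (orthonormalFrame V η x) ∧ IsPositiveFrame V η x (orthonormalFrame V η x) := by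
  obtain ⟨v, hv, hne⟩ := h
  obtain ⟨e, he, heT, hpos⟩ := exists_orthonormal_apply_pos hm _ (η x) hv hne
  exact Classical.epsilon_spec
    (p := fun e : Fin m → E => Orthonormal ℝ e ∧ IsPositiveFrame V η x e) ⟨e, he, heT, hpos⟩

/-- The absolute value of the coefficient of a continuous form with respect to the volume form of an
oriented submanifold is continuous. -/
theorem continuousOn_abs_apply_orthonormalFrame {m : ℕ} (hm : Odd m) {V : Set E}
    {η : E → E [⋀^Fin m]→ₗ[ℝ] ℝ} (hV : IsOrientedSubmanifold m V η)
    {φ : E → E [⋀^Fin m]→L[ℝ] ℝ} (hφ : Continuous fun z : E × (Fin m → E) => φ z.1 z.2) :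
    ContinuousOn (fun x => |φ x (orthonormalFrame V η x)|) V := by
  intro x hx
  obtain ⟨O, W, f, hO, hxO, hW, hf, hinj, hemb, himg⟩ := hV.smooth x hx
  set h : ↥(V ∩ O) → W := fun y => (Equiv.ofInjective _ hemb.injective).symm
    ⟨y, by rw [Set.range_domRestrict, himg]; exact y.2⟩ with hh
  have hfh : ∀ y, f (h y) = y := fun y => by
    have := Equiv.apply_ofInjective_symm hemb.injective
      ⟨(y : E), by rw [Set.range_domRestrict, himg]; exact y.2⟩
    exact this
  have hcont : Continuous h := by
    rw [hemb.continuous_iff]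
    have : (W.domRestrict f) ∘ h = Subtype.val := funext hfh
    rw [this]
    exact continuous_subtype_val
  let v : ↥(V ∩ O) → Fin m → E := fun y i => fderiv ℝ f (h y) (EuclideanSpace.single i 1)
  have hvcont : Continuous v := by
    have h1 : ContinuousOn (fderiv ℝ f) W := hf.continuousOn_fderiv_of_isOpen hW (by simp)
    have h2 : Continuous fun y => fderiv ℝ f (h y) :=
      h1.comp_continuous (continuous_subtype_val.comp hcont) fun y => (h y).2
    exact continuous_pi fun i => h2.clm_apply continuous_const
  have hdet : ∀ y, (Matrix.gram ℝ (v y)).det ≠ 0 := fun y => by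
    rw [Matrix.det_gram_ne_zero_iff_linearIndependent]
    have := (EuclideanSpace.basisFun (Fin m) ℝ).toBasis.linearIndependent.map'
      (fderiv ℝ f (h y)).toLinearMap (LinearMap.ker_eq_bot.2 (hinj _ (h y).2))
    have hv : v y = (fderiv ℝ f (h y)).toLinearMap ∘
        (EuclideanSpace.basisFun (Fin m) ℝ).toBasis := by
      funext i
      simp [v]
    rw [hv]
    exact this
  -- The orthonormal frame is an arbitrary choice at each point, with no regularity in y. Up to
  -- sign, the value of φ on it is expressed through the coordinate frame v, which is continuous.
  have hformula : ∀ y : ↥(V ∩ O), |φ y (orthonormalFrame V η y)| =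
      |φ y (v y)| / √(Matrix.gram ℝ (v y)).det := by
    intro y
    obtain ⟨he, hpos⟩ := orthonormalFrame_spec hm (hV.ne_zero y y.2.1)
    have hstrict : HasStrictFDerivAt f (fderiv ℝ f (h y)) (h y) :=
      (hf.contDiffAt (hW.mem_nhds (h y).2)).hasStrictFDerivAt (by simp)
    have hle := tangentSpaceAt_le_range_fderiv (h y).2 hstrict (hinj _ (h y).2) hemb hO himg
    have hge := range_fderiv_le_tangentSpaceAt hW (h y).2 hstrict.hasFDerivAt
      (V := V) (fun w hw => (himg.subset ⟨w, hw, rfl⟩).1)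
    have hT := le_antisymm hle hge
    rw [hfh] at hT
    have hfd : FiniteDimensional ℝ (tangentSpaceAt V (y : E)) := by
      rw [hT]; infer_instance
    have hfin : finrank ℝ (tangentSpaceAt V (y : E)) = m := by
      rw [hT, LinearMap.finrank_range_of_inj (hinj _ (h y).2)]
      simp
    have := abs_apply_eq_mul_sqrt_det_gram (tangentSpaceAt V (y : E)) hfin
      (φ y).toAlternatingMap he hpos.1 (v := v y) (fun i => by rw [hT]; exact ⟨_, rfl⟩)
    have hp : 0 < (Matrix.gram ℝ (v y)).det :=
      lt_of_le_of_ne (Matrix.posSemidef_gram ℝ (v y)).det_nonneg (hdet y).symm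
    rw [eq_div_iff (Real.sqrt_pos.2 hp).ne']
    exact this.symm
  have hrestr : Continuous fun y : ↥(V ∩ O) => |φ y (orthonormalFrame V η y)| := by
    simp only [hformula]
    refine Continuous.div ?_ ?_ ?_
    · exact (hφ.comp (continuous_subtype_val.prodMk hvcont)).abs
    · refine Continuous.sqrt (Continuous.matrix_det ?_)
      refine continuous_matrix fun i j => ?_
      simp only [Matrix.gram_apply]
      exact ((continuous_apply i).comp hvcont).inner ((continuous_apply j).comp hvcont)
    · intro y
      have hp : 0 < (Matrix.gram ℝ (v y)).det :=
        lt_of_le_of_ne (Matrix.posSemidef_gram ℝ (v y)).det_nonneg (hdet y).symm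
      exact (Real.sqrt_pos.2 hp).ne'
  have hon : ContinuousOn (fun x => |φ x (orthonormalFrame V η x)|) (V ∩ O) :=
    continuousOn_iff_continuous_domRestrict.2 hrestr
  exact (hon x ⟨hx, hxO⟩).mono_of_mem_nhdsWithin
    (Filter.inter_mem self_mem_nhdsWithin (nhdsWithin_le_nhds (hO.mem_nhds hxO)))

end Submanifold

/-! ### Stokes' theorem for singular cubes -/

section Stokes

variable {E : Type*} [NormedAddCommGroup E] [InnerProductSpace ℝ E]

theorem continuous_extDeriv {k : ℕ} {φ : E → E [⋀^Fin k]→L[ℝ] ℝ} (hφ : ContDiff ℝ ∞ φ) :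
    Continuous (extDeriv φ) :=
  (ContinuousAlternatingMap.alternatizeUncurryFinCLM ℝ E ℝ).continuous.comp
    (hφ.continuous_fderiv (by simp))

theorem fderiv_comp_insertNth {k : ℕ} {c : (Fin (k + 1) → ℝ) → E} (hc : ContDiff ℝ ∞ c)
    (i : Fin (k + 1)) (a : ℝ) (t : Fin k → ℝ) (j : Fin k) :
    fderiv ℝ (fun t => c (Fin.insertNth (α := fun _ => ℝ) i a t)) t (Pi.single j 1) =
      fderiv ℝ c (Fin.insertNth (α := fun _ => ℝ) i a t) (Pi.single (i.succAbove j) 1) := by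
  let A : (Fin k → ℝ) →L[ℝ] (Fin (k + 1) → ℝ) :=
    ContinuousLinearMap.pi (i.insertNth (α := fun _ => (Fin k → ℝ) →L[ℝ] ℝ) 0
      fun j => ContinuousLinearMap.proj j)
  have hA : ∀ t l, A t l = (Fin.insertNth (α := fun _ => ℝ) i 0 t) l := fun t l => by
    refine Fin.succAboveCases i ?_ (fun j => ?_) l <;> simp [A]
  have hA' : (fun t => Fin.insertNth (α := fun _ => ℝ) i a t) =
      fun t => A t + Pi.single i a := by
    funext t l
    rw [Pi.add_apply, hA]
    refine Fin.succAboveCases i ?_ (fun j => ?_) l <;> simp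
  have h1 : HasFDerivAt (fun t => Fin.insertNth (α := fun _ => ℝ) i a t) A t := by
    rw [hA']
    exact A.hasFDerivAt.add_const _
  have h2 := ((hc.differentiable (by simp)) (Fin.insertNth (α := fun _ => ℝ) i a t)).hasFDerivAt
  have h3 := (h2.comp t h1).fderiv
  have h4 : A (Pi.single j 1) = Pi.single (i.succAbove j) 1 := by
    funext l
    rw [hA]
    refine Fin.succAboveCases i ?_ (fun j' => ?_) l
    · simp
    · simp [Pi.single_apply]
  rw [Function.comp_def] at h3
  rw [h3, ContinuousLinearMap.comp_apply, h4]

/-- Stokes' theorem for singular cubes. -/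
theorem cubeBoundaryIntegral_eq {k : ℕ} {φ : E → E [⋀^Fin k]→L[ℝ] ℝ} (hφ : ContDiff ℝ ∞ φ)
    {c : (Fin (k + 1) → ℝ) → E} (hc : ContDiff ℝ ∞ c) :
    cubeBoundaryIntegral φ c =
      ∫ t in Set.Icc (0 : Fin (k + 1) → ℝ) 1,
        extDeriv φ (c t) (fun i => fderiv ℝ c t (Pi.single i 1)) := by
  have h2le : (2 : WithTop ℕ∞) ≤ ∞ := WithTop.coe_le_coe.2 (le_top : (2 : ℕ∞) ≤ ⊤)
  set ρ : (Fin (k + 1) → ℝ) → (Fin (k + 1) → ℝ) [⋀^Fin k]→L[ℝ] ℝ :=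
    fun t => (φ (c t)).compContinuousLinearMap (fderiv ℝ c t) with hρ
  let v : Fin (k + 1) → (Fin (k + 1) → ℝ) := fun i => Pi.single i 1
  have hdc : Continuous (fderiv ℝ c) := hc.continuous_fderiv (by simp)
  have hρd : Differentiable ℝ ρ := fun t => by
    have h1 : DifferentiableAt ℝ (fun t => φ (c t)) t :=
      ((hφ.comp hc).differentiable (by simp)) t
    have h2 : DifferentiableAt ℝ (fderiv ℝ c) t :=
      ((hc.fderiv_right (m := 1) (by rw [one_add_one_eq_two]; exact h2le)).differentiable (by simp)) t
    exact (h1.hasFDerivAt.continuousAlternatingMapCompContinuousLinearMap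
      h2.hasFDerivAt).differentiableAt
  -- The vector field dual to the pullback ρ of φ: its divergence is the coefficient of dρ, and its
  -- flux through the faces is the boundary integral.
  let f : Fin (k + 1) → (Fin (k + 1) → ℝ) → ℝ := fun i t => (-1) ^ (i : ℕ) * ρ t (i.removeNth v)
  have hfd : ∀ i, Differentiable ℝ (f i) := fun i t =>
    ((hρd t).continuousAlternatingMap_apply_const (i.removeNth v)).const_mul _
  have hdiv : ∀ t, ∑ i, fderiv ℝ (f i) t (v i) =
      extDeriv φ (c t) (fun i => fderiv ℝ c t (Pi.single i 1)) := fun t => by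
    have h1 := extDeriv_pullback (f := c) (x := t) (r := ∞)
      ((hφ.differentiable (by simp)) (c t)) hc.contDiffAt (by simpa using h2le)
    have h2 := extDeriv_apply (hρd t) v
    rw [hρ, h1] at h2
    refine Eq.trans ?_ h2.symm
    refine Finset.sum_congr rfl fun i _ => ?_
    have := fderiv_const_mul ((hρd t).continuousAlternatingMap_apply_const (i.removeNth v))
      ((-1 : ℝ) ^ (i : ℕ))
    rw [zsmul_eq_mul, Int.cast_pow, Int.cast_neg, Int.cast_one]
    exact (congrArg (fun L => L (v i)) this).trans (smul_apply _ _ _)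
  have hint : IntegrableOn (fun t => ∑ i, fderiv ℝ (f i) t (v i))
      (Set.Icc (0 : Fin (k + 1) → ℝ) 1) := by
    simp only [hdiv]
    refine Continuous.integrableOn_Icc ?_
    exact ((continuous_extDeriv hφ).comp hc.continuous).eval
      (continuous_pi fun i => hdc.clm_apply continuous_const)
  have key := integral_divergence_of_hasFDerivAt_off_countable' (0 : Fin (k + 1) → ℝ) 1
    zero_le_one f (fun i t => fderiv ℝ (f i) t) ∅ Set.countable_empty
    (fun i => (hfd i).continuous.continuousOn) (fun t _ i => (hfd i t).hasFDerivAt) hint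
  simp only [v, hdiv] at key
  rw [key, cubeBoundaryIntegral]
  refine Finset.sum_congr rfl fun i _ => ?_
  have hface : ∀ a : ℝ, ∫ t in Set.Icc ((0 : Fin (k + 1) → ℝ) ∘ i.succAbove)
      ((1 : Fin (k + 1) → ℝ) ∘ i.succAbove),
      f i (i.insertNth (α := fun _ => ℝ) a t) =
      (-1) ^ (i : ℕ) * cubeIntegral φ (fun t => c (Fin.insertNth (α := fun _ => ℝ) i a t)) := by
    intro a
    rw [cubeIntegral, ← integral_const_mul]
    refine integral_congr_ae (Filter.Eventually.of_forall fun t => ?_)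
    simp only [f, hρ, ContinuousAlternatingMap.compContinuousLinearMap_apply,
      fderiv_comp_insertNth hc]
    rfl
  rw [mul_sub]
  exact (congrArg₂ (· - ·) (hface 1) (hface 0)).symm

end Stokes

/-! ### The determinant inequality -/

section Matrix

variable {n : Type*} [Fintype n] [DecidableEq n]

/-- By the matrix determinant lemma, det (P + u uᵀ) = det P · (1 + uᵀ P⁻¹ u), and P⁻¹ is positive
definite. -/
theorem Matrix.PosDef.det_le_det_add_vecMulVec {P : Matrix n n ℝ} (hP : P.PosDef) (u : n → ℝ) :
    P.det ≤ (P + Matrix.vecMulVec u u).det := by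
  have h := Matrix.det_add_replicateCol_mul_replicateRow (ι := Unit)
    (isUnit_iff_ne_zero.2 hP.det_pos.ne') u u
  rw [← Matrix.vecMulVec_eq] at h
  rw [h, Matrix.det_unique (n := Unit)]
  have h1 : 0 ≤ u ⬝ᵥ (P⁻¹.mulVec u) := by
    simpa using hP.inv.posSemidef.dotProduct_mulVec_nonneg u
  have h2 : (Matrix.replicateRow Unit u * P⁻¹ * Matrix.replicateCol Unit u) default default =
      u ⬝ᵥ (P⁻¹.mulVec u) := by
    rw [Matrix.mul_assoc]
    rfl
  rw [Matrix.add_apply, h2, Matrix.one_apply_eq]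
  nlinarith [hP.det_pos]

/-- BᵀB is the sum of the rank one matrices of the rows of B, which are added one at a time;
positive definiteness persists. -/
theorem Matrix.PosDef.det_le_det_add_transpose_mul_self {k : Type*} [Fintype k] {P : Matrix n n ℝ}
    (hP : P.PosDef) (B : Matrix k n ℝ) : P.det ≤ (P + B.transpose * B).det := by
  classical
  have hB : B.transpose * B = ∑ i, Matrix.vecMulVec (B i) (B i) := by
    ext a b
    simp [Matrix.mul_apply, Matrix.sum_apply, Matrix.vecMulVec_apply]
  rw [hB]
  suffices ∀ s : Finset k, (P + ∑ i ∈ s, Matrix.vecMulVec (B i) (B i)).PosDef ∧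
      P.det ≤ (P + ∑ i ∈ s, Matrix.vecMulVec (B i) (B i)).det from (this _).2
  intro s
  induction s using Finset.induction_on with
  | empty => simpa using hP
  | insert a s ha ih =>
    rw [Finset.sum_insert ha, add_comm (Matrix.vecMulVec _ _), ← add_assoc]
    refine ⟨ih.1.add_posSemidef ?_, ih.2.trans (ih.1.det_le_det_add_vecMulVec _)⟩
    simpa using Matrix.posSemidef_vecMulVec_self_star (B a)

/-- If `AᵀA - BᵀB` is positive definite, the root of its determinant is at most `|det A|`. -/
theorem Matrix.PosDef.sqrt_det_le_abs_det {A : Matrix n n ℝ} {k : Type*} [Fintype k]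
    {B : Matrix k n ℝ} (h : (A.transpose * A - B.transpose * B).PosDef) :
    √(A.transpose * A - B.transpose * B).det ≤ |A.det| ∧ A.det ≠ 0 := by
  have h1 := h.det_le_det_add_transpose_mul_self B
  rw [sub_add_cancel, Matrix.det_mul, Matrix.det_transpose] at h1
  refine ⟨?_, fun h0 => ?_⟩
  · rw [← Real.sqrt_mul_self_eq_abs]
    exact Real.sqrt_le_sqrt h1
  · have := h.det_pos
    rw [h0] at h1
    linarith

end Matrix

/-! ### The calibration -/

section Calibration

/-- The entry `(i, j)` of `Fᵀ X`. -/
def frameEntry (i j : Fin 4) : FrameSpace →L[ℝ] FrameSpace →L[ℝ] ℝ :=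
  (innerSL ℝ).bilinearComp (PiLp.proj 2 (fun _ : Fin 4 => R4) i)
    (PiLp.proj 2 (fun _ : Fin 4 => R4) j)

theorem frameEntry_apply (i j : Fin 4) (F X : FrameSpace) :
    frameEntry i j F X = ⟪F i, X j⟫ := rfl

/-- The components of the projections of `Fᵀ X` to the two ideals of `so(4)`, for the signs
`σ = 1` and `σ = -1`. -/
def idealCoframe (σ : ℝ) (i : Fin 3) : FrameSpace →L[ℝ] FrameSpace →L[ℝ] ℝ :=
  (√32)⁻¹ • (![frameEntry 1 0 - frameEntry 0 1, frameEntry 2 0 - frameEntry 0 2,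
      frameEntry 3 0 - frameEntry 0 3] i +
    σ • ![frameEntry 3 2 - frameEntry 2 3, frameEntry 1 3 - frameEntry 3 1,
      frameEntry 2 1 - frameEntry 1 2] i)

theorem idealCoframe_apply (σ : ℝ) (i : Fin 3) (F X : FrameSpace) :
    idealCoframe σ i F X = (√32)⁻¹ * (![⟪F 1, X 0⟫ - ⟪F 0, X 1⟫, ⟪F 2, X 0⟫ - ⟪F 0, X 2⟫,
      ⟪F 3, X 0⟫ - ⟪F 0, X 3⟫] i + σ * ![⟪F 3, X 2⟫ - ⟪F 2, X 3⟫, ⟪F 1, X 3⟫ - ⟪F 3, X 1⟫,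
      ⟪F 2, X 1⟫ - ⟪F 1, X 2⟫] i) := by
  fin_cases i <;> rfl

/-- The alternatization of continuous multilinear forms, as a continuous linear map. -/
def alternatizationCLM (E : Type*) [NormedAddCommGroup E] [NormedSpace ℝ E] (m : ℕ) :
    ContinuousMultilinearMap ℝ (fun _ : Fin m => E) ℝ →L[ℝ] E [⋀^Fin m]→L[ℝ] ℝ :=
  LinearMap.mkContinuous
    { toFun := ContinuousMultilinearMap.alternatization
      map_add' := map_add _
      map_smul' := fun a f => by
        ext v
        simp [ContinuousMultilinearMap.alternatization_apply_apply, Finset.mul_sum,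
          mul_smul_comm] }
    (Fintype.card (Equiv.Perm (Fin m))) fun f => by
      refine ContinuousAlternatingMap.opNorm_le_bound _ (by positivity) fun v => ?_
      simp only [LinearMap.coe_mk, AddHom.coe_mk,
        ContinuousMultilinearMap.alternatization_apply_apply]
      refine (norm_sum_le _ _).trans ?_
      rw [mul_assoc, ← nsmul_eq_mul, ← Finset.card_univ]
      refine Finset.sum_le_card_nsmul _ _ _ fun τ _ => ?_
      have h1 : ‖Equiv.Perm.sign τ • f (v ∘ τ)‖ = ‖f (v ∘ τ)‖ := by
        rcases Int.units_eq_one_or (Equiv.Perm.sign τ) with h | h <;> simp [h]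
      rw [h1]
      refine (f.le_opNorm _).trans_eq ?_
      congr 1
      exact Equiv.prod_comp τ fun i => ‖v i‖

/-- The calibration: the volume form of the first factor of the local product structure of
`SO(S³)`. -/
def calibration (F : FrameSpace) : FrameSpace [⋀^Fin 3]→L[ℝ] ℝ :=
  alternatizationCLM FrameSpace 3
    ((ContinuousMultilinearMap.mkPiAlgebra ℝ (Fin 3) ℝ).compContinuousLinearMap
      fun i => idealCoframe 1 i F)

theorem calibration_apply (F : FrameSpace) (X : Fin 3 → FrameSpace) :
    calibration F X = (Matrix.of fun j i => idealCoframe 1 i F (X j)).det := by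
  rw [Matrix.det_apply]
  refine (ContinuousMultilinearMap.alternatization_apply_apply _ _).trans ?_
  simp

/-- Homology is tested against smooth forms on the whole ambient space, so smoothness is needed off
`SOS3` too. The form is multilinear in the coframe, which is linear in the base point. -/
theorem contDiff_calibration : ContDiff ℝ ∞ calibration := by
  refine (alternatizationCLM FrameSpace 3).contDiff.comp ?_
  have h : ContDiff ℝ ∞ (ContinuousMultilinearMap.compContinuousLinearMapContinuousMultilinear ℝ
      (fun _ : Fin 3 => FrameSpace) (fun _ : Fin 3 => ℝ) ℝ) :=
    ContinuousMultilinearMap.contDiff _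
  exact (h.comp (contDiff_pi.2 fun i => (idealCoframe 1 i).contDiff)).clm_apply contDiff_const

theorem continuous_calibration_eval :
    Continuous fun z : FrameSpace × (Fin 3 → FrameSpace) => calibration z.1 z.2 :=
  (contDiff_calibration.continuous.comp continuous_fst).eval continuous_snd

theorem inner_eq_neg_of_mem_tangentSpaceAt {F X : FrameSpace} (hF : F ∈ SOS3)
    (hX : X ∈ tangentSpaceAt SOS3 F) (i j : Fin 4) : ⟪F i, X j⟫ = -⟪F j, X i⟫ := by
  have hd : HasFDerivAt (fun G : FrameSpace => frameEntry i j G G)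
      (frameEntry i j F + (frameEntry i j).flip F) F :=
    (frameEntry i j).hasFDerivAt.clm_apply (hasFDerivAt_id F)
  have := tangentSpaceAt_le_ker hd (V := SOS3) (a := if i = j then 1 else 0)
    (fun G hG => by simpa [frameEntry_apply] using orthonormal_iff_ite.1 hG.1 i j) hF hX
  have h3 : ⟪F i, X j⟫ + ⟪X i, F j⟫ = 0 := this
  rw [real_inner_comm (F j)] at h3
  linarith

theorem exists_skew_coordinates {F X : FrameSpace} (hF : F ∈ SOS3)
    (hX : X ∈ tangentSpaceAt SOS3 F) :
    ∃ x ξ : Fin 3 → ℝ, ∀ i j, ⟪F i, X j⟫ = zMatrix x ξ i j := by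
  have h := inner_eq_neg_of_mem_tangentSpaceAt hF hX
  have h1 := zMatrix_xPart_ξPart (leftTrivialization F X) (by
    ext i j
    exact h j i)
  exact ⟨_, _, fun i j => (congrFun (congrFun h1 i) j).symm⟩

/-- On tangent vectors the coframes are 2 (x ± ξ) / √32, so this is the polarized identity |x + ξ|²
- |x - ξ|² = 4 ⟨x, ξ⟩. The factor √32 makes the coefficients ±1. -/
theorem splitMetric_eq {F X Y : FrameSpace} (hF : F ∈ SOS3)
    (hX : X ∈ tangentSpaceAt SOS3 F) (hY : Y ∈ tangentSpaceAt SOS3 F) :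
    splitMetric F X Y = ∑ i, idealCoframe 1 i F X * idealCoframe 1 i F Y -
      ∑ i, idealCoframe (-1) i F X * idealCoframe (-1) i F Y := by
  obtain ⟨x, ξ, hx⟩ := exists_skew_coordinates hF hX
  obtain ⟨y, η, hy⟩ := exists_skew_coordinates hF hY
  have h32 : (√32)⁻¹ * (√32)⁻¹ = (1 / 32 : ℝ) := by
    rw [← mul_inv, Real.mul_self_sqrt (by norm_num)]
    norm_num
  set s := (√32 : ℝ)⁻¹ with hs
  simp only [splitMetric, so4Inner, leftTrivialization, xPart, ξPart, idealCoframe_apply,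
    Fin.sum_univ_three, dotProduct, Matrix.of_apply, hx, hy,
    Matrix.cons_val_zero, Matrix.cons_val_one, Matrix.cons_val]
  simp [zMatrix]
  linear_combination (-8 * (x 0 * η 0 + x 1 * η 1 + x 2 * η 2 + y 0 * ξ 0 + y 1 * ξ 1 + y 2 * ξ 2))
    * h32

theorem exists_orthonormalBasis_of_orthonormal {F : FrameSpace} (hF : Orthonormal ℝ fun i => F i) :
    ∃ B : OrthonormalBasis (Fin 4) ℝ R4, ∀ m, B m = F m :=
  ⟨OrthonormalBasis.mk hF
    (by rw [hF.linearIndependent.span_eq_top_of_card_eq_finrank' (by simp)]), fun m => by simp⟩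

/-- The structure equation of the first ideal. Writing X = F A and Y = F B with A, B skew, the skew
part of XᵀY = -AB is half of -[A, B], and the bracket of the ideal is a multiple of the cross
product. The coframe was antisymmetrized in its definition so that only this skew part enters. -/
theorem idealCoframe_apply_tangent {F X Y : FrameSpace} (hF : F ∈ SOS3)
    (hX : X ∈ tangentSpaceAt SOS3 F) (hY : Y ∈ tangentSpaceAt SOS3 F) (i : Fin 3) :
    idealCoframe 1 i X Y = (-(1 / 4) * ((√32)⁻¹)⁻¹) *
      (idealCoframe 1 (i + 1) F X * idealCoframe 1 (i + 2) F Y -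
        idealCoframe 1 (i + 2) F X * idealCoframe 1 (i + 1) F Y) := by
  obtain ⟨x, ξ, hx⟩ := exists_skew_coordinates hF hX
  obtain ⟨y, η, hy⟩ := exists_skew_coordinates hF hY
  have hXY : ∀ a b, ⟪X a, Y b⟫ = ∑ m, zMatrix x ξ m a * zMatrix y η m b := fun a b => by
    obtain ⟨B, hB⟩ := exists_orthonormalBasis_of_orthonormal hF.1
    rw [← B.sum_inner_mul_inner]
    refine Finset.sum_congr rfl fun m _ => ?_
    rw [hB, real_inner_comm, hx, hy]
  have hs : ((√32 : ℝ)⁻¹)⁻¹ * (√32)⁻¹ = 1 := inv_mul_cancel₀ (by positivity)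
  set s := (√32 : ℝ)⁻¹
  have hE : ∀ j, idealCoframe 1 j F X = 2 * s * (x j + ξ j) := fun j => by
    fin_cases j <;>
      · simp [idealCoframe_apply, hx, zMatrix]
        ring
  have hE' : ∀ j, idealCoframe 1 j F Y = 2 * s * (y j + η j) := fun j => by
    fin_cases j <;>
      · simp [idealCoframe_apply, hy, zMatrix]
        ring
  rw [hE, hE, hE', hE']
  have hL : idealCoframe 1 i X Y = -s * ((x (i + 1) + ξ (i + 1)) * (y (i + 2) + η (i + 2)) -
      (x (i + 2) + ξ (i + 2)) * (y (i + 1) + η (i + 1))) := by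
    fin_cases i <;>
      · simp [idealCoframe_apply, hXY, zMatrix, Fin.sum_univ_four]
        ring
  rw [hL]
  linear_combination (s * ((x (i + 1) + ξ (i + 1)) * (y (i + 2) + η (i + 2)) -
      (x (i + 2) + ξ (i + 2)) * (y (i + 1) + η (i + 1)))) * hs

/-- The determinant is invariant under the adjoint action of `so(3)`. -/
theorem hasDerivAt_det_cross (k : ℝ) (x : Fin 3 → ℝ) (a : Fin 3 → Fin 3 → ℝ) :
    HasDerivAt (fun t : ℝ => (Matrix.of fun j i =>
      a j i + t * (k * (x (i + 1) * a j (i + 2) - x (i + 2) * a j (i + 1)))).det) 0 0 := by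
  set f : ℝ → ℝ := fun t => (Matrix.of fun j i =>
      a j i + t * (k * (x (i + 1) * a j (i + 2) - x (i + 2) * a j (i + 1)))).det with hf
  -- The function f is a cubic polynomial without linear term, since its derivative at 0 is det a
  -- times the trace of a cross product operator, which is 0. The other coefficients are read off
  -- from the values at 0, 1 and -1.
  have h : f = fun t => f 0 +
      t ^ 2 * ((f 1 + f (-1)) / 2 - f 0 + t * ((f 1 - f (-1)) / 2)) := by
    funext t
    simp only [hf, Matrix.det_fin_three, Matrix.of_apply, Fin.reduceAdd]
    ring
  rw [h]
  have h1 := ((hasDerivAt_pow 2 (0 : ℝ)).mul (((hasDerivAt_id (0 : ℝ)).mul_const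
    ((f 1 - f (-1)) / 2)).const_add ((f 1 + f (-1)) / 2 - f 0))).const_add (f 0)
  simpa using h1

/-- The coframe is linear in its base point, so moving F along X adds to each row θ⁺(Y j) a multiple
of θ⁺(X) × θ⁺(Y j). To first order this does not change the determinant. -/
theorem fderiv_calibration_tangent {F X : FrameSpace} {Y : Fin 3 → FrameSpace} (hF : F ∈ SOS3)
    (hX : X ∈ tangentSpaceAt SOS3 F) (hY : ∀ j, Y j ∈ tangentSpaceAt SOS3 F) :
    fderiv ℝ (fun G => calibration G Y) F X = 0 := by
  have hd : DifferentiableAt ℝ (fun G => calibration G Y) F :=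
    ((contDiff_calibration.differentiable (by simp)) F).continuousAlternatingMap_apply_const Y
  rw [← hd.lineDeriv_eq_fderiv]
  have hline : (fun t : ℝ => calibration (F + t • X) Y) = fun t => (Matrix.of fun j i =>
      idealCoframe 1 i F (Y j) + t * ((-(1 / 4) * ((√32)⁻¹)⁻¹) *
        (idealCoframe 1 (i + 1) F X * idealCoframe 1 (i + 2) F (Y j) -
          idealCoframe 1 (i + 2) F X * idealCoframe 1 (i + 1) F (Y j)))).det := by
    funext t
    rw [calibration_apply]
    congr 2
    funext j i
    rw [map_add, map_smul, add_apply, smul_apply, idealCoframe_apply_tangent hF hX (hY j),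
      smul_eq_mul]
  rw [lineDeriv, hline]
  exact (hasDerivAt_det_cross _ (fun i => idealCoframe 1 i F X)
    (fun j i => idealCoframe 1 i F (Y j))).deriv

theorem extDeriv_calibration_tangent {F : FrameSpace} {X : Fin 4 → FrameSpace} (hF : F ∈ SOS3)
    (hX : ∀ j, X j ∈ tangentSpaceAt SOS3 F) : extDeriv calibration F X = 0 := by
  rw [extDeriv_apply (contDiff_calibration.differentiable (by simp) F)]
  refine Finset.sum_eq_zero fun i _ => ?_
  rw [fderiv_calibration_tangent (Y := i.removeNth X) hF (hX i) fun j => hX _, smul_zero]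

theorem cubeBoundaryIntegral_calibration {c : (Fin 4 → ℝ) → FrameSpace} (hc : ContDiff ℝ ∞ c)
    (hcN : ∀ t ∈ Set.Icc (0 : Fin 4 → ℝ) 1, c t ∈ SOS3) :
    cubeBoundaryIntegral calibration c = 0 := by
  rw [cubeBoundaryIntegral_eq contDiff_calibration hc]
  -- The cube is known to lie in `SOS3` only over the closed unit cube. On the open cube, of full
  -- measure, its partial derivatives are tangent to `SOS3`.
  have hae : Set.pi Set.univ (fun i => Set.Ioo ((0 : Fin 4 → ℝ) i) ((1 : Fin 4 → ℝ) i)) =ᵐ[volume]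
      Set.Icc (0 : Fin 4 → ℝ) 1 := Measure.univ_pi_Ioo_ae_eq_Icc
  rw [← setIntegral_congr_set hae]
  have hopen : IsOpen (Set.pi Set.univ
      (fun i => Set.Ioo ((0 : Fin 4 → ℝ) i) ((1 : Fin 4 → ℝ) i))) :=
    isOpen_set_pi Set.finite_univ fun i _ => isOpen_Ioo
  have hmaps : Set.MapsTo c (Set.pi Set.univ
      (fun i => Set.Ioo ((0 : Fin 4 → ℝ) i) ((1 : Fin 4 → ℝ) i))) SOS3 := fun t ht =>
    hcN t ⟨fun i => (ht i trivial).1.le, fun i => (ht i trivial).2.le⟩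
  refine setIntegral_eq_zero_of_forall_eq_zero fun t ht => ?_
  refine extDeriv_calibration_tangent (hmaps ht) fun j => ?_
  exact range_fderiv_le_tangentSpaceAt hopen ht
    ((hc.differentiable (by simp)) t).hasFDerivAt hmaps ⟨_, rfl⟩

theorem gramMatrix_splitMetric {F : FrameSpace} {m : ℕ} {X : Fin m → FrameSpace} (hF : F ∈ SOS3)
    (hX : ∀ j, X j ∈ tangentSpaceAt SOS3 F) :
    gramMatrix splitMetric F X =
      (Matrix.of fun i j => idealCoframe 1 i F (X j)).transpose *
        (Matrix.of fun i j => idealCoframe 1 i F (X j)) -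
      (Matrix.of fun i j => idealCoframe (-1) i F (X j)).transpose *
        (Matrix.of fun i j => idealCoframe (-1) i F (X j)) := by
  ext a b
  simp [gramMatrix, Matrix.mul_apply, splitMetric_eq hF (hX a) (hX b)]

/-- A frame of a space-like subspace has a positive definite Gram matrix. -/
theorem posDef_gramMatrix_splitMetric {F : FrameSpace} {m : ℕ} {X : Fin m → FrameSpace}
    (hF : F ∈ SOS3) {T : Submodule ℝ FrameSpace} (hT : T ≤ tangentSpaceAt SOS3 F)
    (hpos : ∀ v ∈ T, v ≠ 0 → 0 < splitMetric F v v) (hX : ∀ j, X j ∈ T)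
    (hli : LinearIndependent ℝ X) : (gramMatrix splitMetric F X).PosDef := by
  have hG := gramMatrix_splitMetric hF fun j => hT (hX j)
  refine Matrix.PosDef.of_dotProduct_mulVec_pos ?_ fun c hc => ?_
  · rw [hG]
    refine Matrix.IsHermitian.ext fun i j => ?_
    simp [Matrix.mul_apply, mul_comm]
  · have hv : ∑ j, c j • X j ∈ T := T.sum_mem fun j _ => T.smul_mem _ (hX j)
    have hv0 : ∑ j, c j • X j ≠ 0 := fun h0 =>
      hc (funext (Fintype.linearIndependent_iff.1 hli c h0))
    have h1 := hpos _ hv hv0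
    rw [splitMetric_eq hF (hT hv) (hT hv)] at h1
    have h2 : ∀ (σ : ℝ) (i : Fin 3), idealCoframe σ i F (∑ j, c j • X j) =
        ((Matrix.of fun i j => idealCoframe σ i F (X j)).mulVec c) i := fun σ i => by
      simp [Matrix.mulVec, dotProduct, mul_comm]
    simp only [h2] at h1
    have h3 : ∀ A : Matrix (Fin 3) (Fin m) ℝ,
        star c ⬝ᵥ (A.transpose * A).mulVec c = A.mulVec c ⬝ᵥ A.mulVec c := fun A => by
      rw [star_trivial, ← Matrix.mulVec_mulVec, Matrix.dotProduct_mulVec, Matrix.vecMul_transpose]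
    rw [hG, Matrix.sub_mulVec, dotProduct_sub, h3, h3]
    exact h1

/-- The calibration bounds the volume of space-like frames. -/
theorem sqrt_det_gramMatrix_le {F : FrameSpace} {X : Fin 3 → FrameSpace}
    (h : (F, X) ∈ spacelikeFrames 3 SOS3 splitMetric) :
    √(gramMatrix splitMetric F X).det ≤ |calibration F X| ∧ calibration F X ≠ 0 := by
  obtain ⟨hF, hX, hpos⟩ := h
  dsimp only at hpos
  rw [gramMatrix_splitMetric hF hX] at hpos ⊢
  rw [calibration_apply, ← Matrix.det_transpose (Matrix.of _)]
  exact hpos.sqrt_det_le_abs_det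

/-- The calibration does not change its sign along paths of space-like frames. -/
theorem calibration_mul_pos_of_joinedIn {z z' : FrameSpace × (Fin 3 → FrameSpace)}
    (h : JoinedIn (spacelikeFrames 3 SOS3 splitMetric) z z') :
    0 < calibration z.1 z.2 * calibration z'.1 z'.2 := by
  set f : unitInterval → ℝ := fun t => calibration (h.somePath t).1 (h.somePath t).2 with hf
  have hcont : Continuous f := continuous_calibration_eval.comp h.somePath.continuous
  have hne : ∀ t, f t ≠ 0 := fun t => (sqrt_det_gramMatrix_le (h.somePath_mem t)).2
  have h0 : f 0 = calibration z.1 z.2 := by simp [hf]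
  have h1 : f 1 = calibration z'.1 z'.2 := by simp [hf]
  rw [← h0, ← h1]
  by_contra hle
  -- Values of opposite sign at the ends would force a zero in between, but the calibration vanishes
  -- on no space-like frame.
  have hz : (0 : ℝ) ∈ Set.range f := by
    rcases mul_nonpos_iff.1 (not_lt.1 hle) with h | h
    · exact mem_range_of_exists_le_of_exists_ge hcont ⟨1, h.2⟩ ⟨0, h.1⟩
    · exact mem_range_of_exists_le_of_exists_ge hcont ⟨0, h.1⟩ ⟨1, h.2⟩
  obtain ⟨t, ht⟩ := hz
  exact hne t ht

end Calibration

/-! ### The left invariant section -/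

section LeftSection

theorem quatMul_apply (p x : R4) : quatMul p x =
    !₂[p 0 * x 0 - p 1 * x 1 - p 2 * x 2 - p 3 * x 3,
      p 0 * x 1 + p 1 * x 0 + p 2 * x 3 - p 3 * x 2,
      p 0 * x 2 - p 1 * x 3 + p 2 * x 0 + p 3 * x 1,
      p 0 * x 3 + p 1 * x 2 - p 2 * x 1 + p 3 * x 0] := by
  ext i
  fin_cases i <;> simp only [quatMul]
  exacts [Quaternion.re_mul _ _, Quaternion.imI_mul _ _, Quaternion.imJ_mul _ _,
    Quaternion.imK_mul _ _]

theorem quatMul_add (p x y : R4) : quatMul p (x + y) = quatMul p x + quatMul p y := by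
  ext i
  simp only [quatMul_apply, PiLp.add_apply]
  fin_cases i <;> simp <;> ring

theorem quatMul_smul (a : ℝ) (p x : R4) : quatMul p (a • x) = a • quatMul p x := by
  ext i
  simp only [quatMul_apply, PiLp.smul_apply, smul_eq_mul]
  fin_cases i <;> simp <;> ring

theorem add_quatMul (p q x : R4) : quatMul (p + q) x = quatMul p x + quatMul q x := by
  ext i
  simp only [quatMul_apply, PiLp.add_apply]
  fin_cases i <;> simp <;> ring

theorem smul_quatMul (a : ℝ) (p x : R4) : quatMul (a • p) x = a • quatMul p x := by
  ext i
  simp only [quatMul_apply, PiLp.smul_apply, smul_eq_mul]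
  fin_cases i <;> simp <;> ring

theorem leftSection_eq_quatMul (p : R4) (i : Fin 4) : leftSection p i = quatMul p (e4 i) := by
  let L : R4 →L[ℝ] R4 := LinearMap.toContinuousLinearMap
    { toFun := quatMul p
      map_add' := quatMul_add p
      map_smul' := fun a x => quatMul_smul a p x }
  have h : fderiv ℝ (fun x => quatMul p x) (e4 0) = L := L.fderiv
  by_cases hi : i = 0
  · subst hi
    rw [quatMul_apply]
    ext j
    fin_cases j <;> simp [leftSection]
  · simp only [leftSection, h, if_neg hi]
    rfl

theorem leftSection_apply (p : R4) (i : Fin 4) : leftSection p i =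
    ![!₂[p 0, p 1, p 2, p 3], !₂[-p 1, p 0, p 3, -p 2], !₂[-p 2, -p 3, p 0, p 1],
      !₂[-p 3, p 2, -p 1, p 0]] i := by
  rw [leftSection_eq_quatMul, quatMul_apply]
  fin_cases i <;> ext j <;> fin_cases j <;> simp

theorem leftSection_zero (p : R4) : leftSection p 0 = p := rfl

theorem leftSection_add (p q : R4) : leftSection (p + q) = leftSection p + leftSection q := by
  ext1 i
  rw [PiLp.add_apply]
  simp only [leftSection_eq_quatMul, add_quatMul]

theorem leftSection_smul (a : ℝ) (p : R4) : leftSection (a • p) = a • leftSection p := by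
  ext1 i
  rw [PiLp.smul_apply]
  simp only [leftSection_eq_quatMul, smul_quatMul]

theorem isLinearMap_leftSection : IsLinearMap ℝ leftSection :=
  ⟨leftSection_add, leftSection_smul⟩

theorem continuous_leftSection : Continuous leftSection := by
  have h : ∀ i, Continuous fun p => quatMul p (e4 i) := fun i =>
    (IsLinearMap.mk' (fun p => quatMul p (e4 i))
      ⟨fun p q => add_quatMul p q _, fun a p => smul_quatMul a p _⟩).continuous_of_finiteDimensional
  simp only [← leftSection_eq_quatMul] at h
  exact (PiLp.continuous_toLp 2 _).comp (continuous_pi h)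

/-- The section `leftSection` extends to a linear map of `ℝ⁴`. -/
def leftSectionCLM : R4 →L[ℝ] FrameSpace :=
  ⟨isLinearMap_leftSection.mk', continuous_leftSection⟩

theorem leftSectionCLM_apply (p : R4) : leftSectionCLM p = leftSection p := rfl

theorem contDiff_leftSection : ContDiff ℝ ∞ leftSection := leftSectionCLM.contDiff

theorem inner_leftSection (p v : R4) (i : Fin 4) :
    ⟪leftSection p i, v⟫ = ![p 0 * v 0 + p 1 * v 1 + p 2 * v 2 + p 3 * v 3,
      p 0 * v 1 - p 1 * v 0 - p 2 * v 3 + p 3 * v 2,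
      p 0 * v 2 + p 1 * v 3 - p 2 * v 0 - p 3 * v 1,
      p 0 * v 3 - p 1 * v 2 + p 2 * v 1 - p 3 * v 0] i := by
  rw [leftSection_apply]
  fin_cases i <;> simp [PiLp.inner_apply, Fin.sum_univ_four] <;> ring

theorem sum_sq_eq_one {p : R4} (hp : p ∈ S3) : p 0 ^ 2 + p 1 ^ 2 + p 2 ^ 2 + p 3 ^ 2 = 1 := by
  have h := EuclideanSpace.real_norm_sq_eq p
  rw [mem_sphere_zero_iff_norm.1 hp, Fin.sum_univ_four] at h
  linarith

theorem leftSection_mem_SOS3 {p : R4} (hp : p ∈ S3) : leftSection p ∈ SOS3 := by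
  have h := sum_sq_eq_one hp
  refine ⟨orthonormal_iff_ite.2 fun i j => ?_, ?_⟩
  · rw [inner_leftSection, leftSection_apply]
    fin_cases i <;> fin_cases j <;> simp <;> linarith
  · have hd : (Matrix.of fun i j => leftSection p i j).det =
        (p 0 ^ 2 + p 1 ^ 2 + p 2 ^ 2 + p 3 ^ 2) ^ 2 := by
      simp only [leftSection_apply]
      simp [Matrix.det_succ_row_zero, Fin.sum_univ_succ, Fin.succAbove]
      ring
    rw [hd, h]
    norm_num

theorem isCompact_image_leftSection : IsCompact (leftSection '' S3) :=
  (isCompact_sphere 0 1).image contDiff_leftSection.continuous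

theorem image_leftSection_subset : leftSection '' S3 ⊆ SOS3 := by
  rintro _ ⟨p, hp, rfl⟩
  exact leftSection_mem_SOS3 hp

/-- The section is the restriction of a linear map, so its image satisfies the linear equation F =
b(F 0), which its tangent vectors inherit. Orthogonality to p comes from the skewness of Fᵀ X. -/
theorem eq_leftSection_of_mem_tangentSpaceAt {p : R4} (hp : p ∈ S3) {X : FrameSpace}
    (hX : X ∈ tangentSpaceAt (leftSection '' S3) (leftSection p)) :
    X = leftSection (X 0) ∧ ⟪p, X 0⟫ = 0 := by
  constructor
  · let L : FrameSpace →L[ℝ] FrameSpace :=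
      ContinuousLinearMap.id ℝ FrameSpace -
        leftSectionCLM ∘L (PiLp.proj 2 (fun _ : Fin 4 => R4) 0)
    have := tangentSpaceAt_le_ker (L.hasFDerivAt (x := leftSection p)) (V := leftSection '' S3)
      (a := 0) (by rintro _ ⟨q, -, rfl⟩; exact sub_self _) ⟨p, hp, rfl⟩ hX
    exact sub_eq_zero.1 this
  · have := inner_eq_neg_of_mem_tangentSpaceAt (leftSection_mem_SOS3 hp)
      (tangentSpaceAt_mono image_leftSection_subset _ hX) 0 0
    rw [leftSection_zero] at this
    linarith

theorem idealCoframe_one_leftSection (p v : R4) (i : Fin 3) :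
    idealCoframe 1 i (leftSection p) (leftSection v) =
      4 * (√32)⁻¹ * ⟪leftSection p i.succ, v⟫ := by
  rw [idealCoframe_apply]
  simp only [inner_leftSection]
  fin_cases i <;> simp [leftSection_apply] <;> ring

/-- The matrix b(p)ᵀ b(v) is left multiplication by the quaternion p̄v, whose skew part has x = ξ.
-/
theorem idealCoframe_neg_one_leftSection (p v : R4) (i : Fin 3) :
    idealCoframe (-1) i (leftSection p) (leftSection v) = 0 := by
  rw [idealCoframe_apply]
  simp only [inner_leftSection]
  fin_cases i <;> simp [leftSection_apply] <;> ring

theorem isSpacelike_image_leftSection : IsSpacelike splitMetric (leftSection '' S3) := by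
  rintro _ ⟨p, hp, rfl⟩ X hX hX0
  have hXN := tangentSpaceAt_mono image_leftSection_subset _ hX
  obtain ⟨hXv, horth⟩ := eq_leftSection_of_mem_tangentSpaceAt hp hX
  have hN := leftSection_mem_SOS3 hp
  rw [splitMetric_eq hN hXN hXN, hXv]
  simp only [idealCoframe_neg_one_leftSection, idealCoframe_one_leftSection, mul_zero,
    Finset.sum_const_zero, sub_zero]
  have hv : X 0 ≠ 0 := fun h0 => hX0 (by rw [hXv, h0, ← leftSectionCLM_apply, map_zero])
  obtain ⟨B, hB⟩ := exists_orthonormalBasis_of_orthonormal hN.1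
  have h1 := B.sum_sq_norm_inner_right (X 0)
  rw [Fin.sum_univ_succ] at h1
  simp only [hB, leftSection_zero, horth, norm_zero, Real.norm_eq_abs, sq_abs] at h1
  have h2 : ∑ i : Fin 3, 4 * (√32)⁻¹ * ⟪leftSection p i.succ, X 0⟫ *
      (4 * (√32)⁻¹ * ⟪leftSection p i.succ, X 0⟫) = (4 * (√32)⁻¹) ^ 2 * ‖X 0‖ ^ 2 := by
    rw [← h1]
    simp only [Fin.sum_univ_three]
    ring
  rw [h2]
  have := norm_pos_iff.2 hv
  positivity

theorem sphereOrientation_apply (F : FrameSpace) (X : Fin 3 → FrameSpace) :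
    sphereOrientation F X =
      (Matrix.of fun i j => (Fin.cons (F 0) (fun k => X k 0) : Fin 4 → R4) j i).det := by
  rw [sphereOrientation, AlternatingMap.compLinearMap_apply, AlternatingMap.curryLeft_apply_apply,
    Basis.det_apply]
  rfl

/-- On the image of the section, the volume form is the calibration. -/
theorem calibration_eq_sqrt_det_gramMatrix {p : R4} (hp : p ∈ S3) {X : Fin 3 → FrameSpace}
    (hX : IsPositiveFrame (leftSection '' S3) sphereOrientation (leftSection p) X) :
    calibration (leftSection p) X = √(gramMatrix splitMetric (leftSection p) X).det := by
  have hN := leftSection_mem_SOS3 hp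
  have hXN : ∀ j, X j ∈ tangentSpaceAt SOS3 (leftSection p) := fun j =>
    tangentSpaceAt_mono image_leftSection_subset _ (hX.1 j)
  have hXv := fun j => eq_leftSection_of_mem_tangentSpaceAt hp (hX.1 j)
  set A : Matrix (Fin 3) (Fin 3) ℝ :=
    Matrix.of fun j i => idealCoframe 1 i (leftSection p) (X j) with hA
  have hG : gramMatrix splitMetric (leftSection p) X = A * A.transpose := by
    ext a b
    have h0 : ∀ j i, idealCoframe (-1) i (leftSection p) (X j) = 0 := fun j i => by
      rw [(hXv j).1, idealCoframe_neg_one_leftSection]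
    simp [gramMatrix, Matrix.mul_apply, splitMetric_eq hN (hXN a) (hXN b), hA, h0]
  have hpos : 0 < A.det := by
    have h1 := hX.2
    rw [sphereOrientation_apply] at h1
    set V : Matrix (Fin 4) (Fin 4) ℝ := Matrix.of fun i j =>
      (Fin.cons (leftSection p 0) (fun k => X k 0) : Fin 4 → R4) j i with hV
    -- The frame b(p) and the frame (p, X 0 0, X 1 0, X 2 0) are both positive. The product of their
    -- matrices has first column (1, 0, 0, 0), so its determinant is the 3 × 3 minor of inner
    -- products, of which A is a positive multiple up to transposition.
    have h2 := mul_pos hN.2 h1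
    rw [← Matrix.det_mul] at h2
    have h3 : ∀ i j, ((Matrix.of fun i j => leftSection p i j) * V) i j =
        ⟪leftSection p i, (Fin.cons (leftSection p 0) (fun k => X k 0) : Fin 4 → R4) j⟫ :=
      fun i j => by
        simp [Matrix.mul_apply, hV, PiLp.inner_apply, mul_comm]
    have h4 : ((Matrix.of fun i j => leftSection p i j) * V).det =
        (Matrix.of fun i j : Fin 3 => ⟪leftSection p i.succ, X j 0⟫).det := by
      rw [Matrix.det_succ_column_zero, Fin.sum_univ_succ, Finset.sum_eq_zero]
      · have h5 : ((Matrix.of fun i j => leftSection p i j) * V).submatrix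
            (Fin.succAbove 0) Fin.succ =
            Matrix.of fun i j : Fin 3 => ⟪leftSection p i.succ, X j 0⟫ := by
          ext i j
          rw [Matrix.submatrix_apply, h3]
          simp
        rw [h5, h3, Fin.cons_zero, orthonormal_iff_ite.1 hN.1 0 0]
        simp
      · intro i _
        rw [h3, Fin.cons_zero, orthonormal_iff_ite.1 hN.1 i.succ 0]
        simp
    rw [h4] at h2
    have h6 : A = (4 * (√32)⁻¹) •
        (Matrix.of fun i j : Fin 3 => ⟪leftSection p i.succ, X j 0⟫).transpose := by
      ext j i
      have := (congrArg (idealCoframe 1 i (leftSection p)) (hXv j).1).trans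
        (idealCoframe_one_leftSection p (X j 0) i)
      exact this
    rw [h6, Matrix.det_smul, Matrix.det_transpose]
    positivity
  rw [calibration_apply, ← hA, hG, Matrix.det_mul, Matrix.det_transpose,
    Real.sqrt_mul_self hpos.le]

end LeftSection

/-! ### Hemisphere charts and the orientation of the image -/

section Chart

/-- The parametrization of a hemisphere centred at `p` by the unit ball of `T_p S³`. -/
def hemisphereParam (p : R4) (w : EuclideanSpace ℝ (Fin 3)) : R4 :=
  √(1 - ‖w‖ ^ 2) • p + ∑ j, w j • leftSection p (Fin.succ j)

/-- The coordinates of the orthogonal projection to `T_p S³`. -/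
def tangentCoordinates (p : R4) : FrameSpace →L[ℝ] EuclideanSpace ℝ (Fin 3) :=
  (EuclideanSpace.equiv (Fin 3) ℝ).symm.toContinuousLinearMap ∘L
    ContinuousLinearMap.pi fun j : Fin 3 =>
      innerSL ℝ (leftSection p j.succ) ∘L PiLp.proj 2 (fun _ : Fin 4 => R4) 0

theorem tangentCoordinates_apply (p : R4) (F : FrameSpace) (j : Fin 3) :
    tangentCoordinates p F j = ⟪leftSection p j.succ, F 0⟫ := rfl

variable {p : R4}

theorem inner_hemisphereParam (hp : p ∈ S3) (w : EuclideanSpace ℝ (Fin 3)) (j : Fin 3) :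
    ⟪leftSection p j.succ, hemisphereParam p w⟫ = w j := by
  have h := orthonormal_iff_ite.1 (leftSection_mem_SOS3 hp).1
  have h0 := h j.succ 0
  rw [leftSection_zero, if_neg (Fin.succ_ne_zero j)] at h0
  simp [hemisphereParam, inner_add_right, inner_smul_right, inner_sum, h, h0]

theorem inner_center_hemisphereParam (hp : p ∈ S3) (w : EuclideanSpace ℝ (Fin 3)) :
    ⟪p, hemisphereParam p w⟫ = √(1 - ‖w‖ ^ 2) := by
  have h := orthonormal_iff_ite.1 (leftSection_mem_SOS3 hp).1 0
  simp only [leftSection_zero] at h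
  have h1 := h 0
  rw [leftSection_zero, if_pos rfl] at h1
  have h2 : ∀ j : Fin 3, ⟪p, leftSection p j.succ⟫ = 0 := fun j => by
    rw [h, if_neg (Fin.succ_ne_zero j).symm]
  simp only [hemisphereParam, inner_add_right, inner_smul_right, inner_sum, h1, h2]
  simp

theorem norm_sq_eq_inner_center_add (hp : p ∈ S3) (v : R4) :
    ‖v‖ ^ 2 = ⟪p, v⟫ ^ 2 + ∑ j : Fin 3, ⟪leftSection p j.succ, v⟫ ^ 2 := by
  obtain ⟨B, hB⟩ := exists_orthonormalBasis_of_orthonormal (leftSection_mem_SOS3 hp).1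
  rw [← B.sum_sq_norm_inner_right v, Fin.sum_univ_succ]
  simp only [hB, leftSection_zero, Real.norm_eq_abs, sq_abs]

theorem hemisphereParam_mem (hp : p ∈ S3) {w : EuclideanSpace ℝ (Fin 3)} (hw : ‖w‖ < 1) :
    hemisphereParam p w ∈ S3 := by
  have h := norm_sq_eq_inner_center_add hp (hemisphereParam p w)
  have h1 : 0 ≤ 1 - ‖w‖ ^ 2 := by nlinarith [norm_nonneg w]
  simp only [inner_hemisphereParam hp, inner_center_hemisphereParam hp, Real.sq_sqrt h1,
    ← EuclideanSpace.real_norm_sq_eq w] at h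
  rw [mem_sphere_zero_iff_norm, ← sq_eq_sq₀ (norm_nonneg _) zero_le_one, h]
  ring

theorem eq_of_inner_leftSection_eq (hp : p ∈ S3) {v v' : R4} (h0 : ⟪p, v⟫ = ⟪p, v'⟫)
    (h : ∀ j : Fin 3, ⟪leftSection p j.succ, v⟫ = ⟪leftSection p j.succ, v'⟫) : v = v' := by
  have h1 := norm_sq_eq_inner_center_add hp (v - v')
  simp only [inner_sub_right, h0, h, sub_self] at h1
  simpa [sub_eq_zero] using h1

theorem exists_hemisphereParam_eq (hp : p ∈ S3) {v : R4} (hv : v ∈ S3) (hpv : 0 < ⟪p, v⟫) :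
    ∃ w : EuclideanSpace ℝ (Fin 3), ‖w‖ < 1 ∧ hemisphereParam p w = v := by
  have h := norm_sq_eq_inner_center_add hp v
  set w : EuclideanSpace ℝ (Fin 3) :=
    WithLp.toLp 2 fun j : Fin 3 => ⟪leftSection p j.succ, v⟫ with hw
  have h1 : ‖w‖ ^ 2 = 1 - ⟪p, v⟫ ^ 2 := by
    rw [EuclideanSpace.real_norm_sq_eq w]
    rw [mem_sphere_zero_iff_norm.1 hv] at h
    simp only [hw]
    linarith
  refine ⟨w, ?_, ?_⟩
  · nlinarith [norm_nonneg w]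
  · refine eq_of_inner_leftSection_eq hp ?_ fun j => ?_
    · rw [inner_center_hemisphereParam hp, h1, sub_sub_cancel, Real.sqrt_sq hpv.le]
    · rw [inner_hemisphereParam hp]

theorem contDiffOn_hemisphereParam (p : R4) :
    ContDiffOn ℝ ∞ (fun w => leftSectionCLM (hemisphereParam p w)) (Metric.ball 0 1) := by
  refine leftSectionCLM.contDiff.comp_contDiffOn ?_
  refine ContDiffOn.add (ContDiffOn.smul (ContDiffOn.sqrt ?_ ?_) contDiffOn_const) ?_
  · exact (contDiff_const.sub (contDiff_norm_sq ℝ)).contDiffOn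
  · intro w hw
    rw [mem_ball_zero_iff] at hw
    nlinarith [norm_nonneg w]
  · refine ContDiff.contDiffOn (ContDiff.sum fun j _ => ?_)
    have h : ContDiff ℝ ∞ fun w : EuclideanSpace ℝ (Fin 3) => w j :=
      (EuclideanSpace.proj (𝕜 := ℝ) j).contDiff
    exact h.smul contDiff_const

theorem tangentCoordinates_hemisphereParam (hp : p ∈ S3) (w : EuclideanSpace ℝ (Fin 3)) :
    tangentCoordinates p (leftSectionCLM (hemisphereParam p w)) = w := by
  ext j
  rw [tangentCoordinates_apply, leftSectionCLM_apply, leftSection_zero, inner_hemisphereParam hp]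

theorem tangentCoordinates_fderiv (hp : p ∈ S3) {w : EuclideanSpace ℝ (Fin 3)}
    (hw : w ∈ Metric.ball (0 : EuclideanSpace ℝ (Fin 3)) 1) (u : EuclideanSpace ℝ (Fin 3)) :
    tangentCoordinates p (fderiv ℝ (fun w => leftSectionCLM (hemisphereParam p w)) w u) = u := by
  have h1 := ((contDiffOn_hemisphereParam p).contDiffAt (Metric.isOpen_ball.mem_nhds hw)
    |>.differentiableAt (by simp)).hasFDerivAt
  have h2 := (tangentCoordinates p).hasFDerivAt.comp w h1
  have h3 : tangentCoordinates p ∘ (fun w => leftSectionCLM (hemisphereParam p w)) = id :=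
    funext (tangentCoordinates_hemisphereParam hp)
  rw [h3] at h2
  exact congrArg (fun L => L u) (h2.unique (hasFDerivAt_id w))

theorem isSmoothSubmanifold_image_leftSection : IsSmoothSubmanifold 3 (leftSection '' S3) := by
  rintro _ ⟨p, hp, rfl⟩
  have hcont : Continuous fun F : FrameSpace => ⟪p, F 0⟫ :=
    continuous_const.inner (PiLp.continuous_apply 2 _ 0)
  refine ⟨{F | 0 < ⟪p, F 0⟫}, Metric.ball 0 1, fun w => leftSectionCLM (hemisphereParam p w),
    isOpen_lt continuous_const hcont, ?_, Metric.isOpen_ball, contDiffOn_hemisphereParam p,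
    fun w hw => ?_, ?_, ?_⟩
  · simp [leftSection_zero, mem_sphere_zero_iff_norm.1 hp]
  · exact Function.LeftInverse.injective (tangentCoordinates_fderiv hp hw)
  -- The continuous linear map `tangentCoordinates p` is a left inverse of the parametrization.
  · refine Topology.IsEmbedding.of_comp (g := tangentCoordinates p)
      (contDiffOn_hemisphereParam p).continuousOn.domRestrict (tangentCoordinates p).continuous ?_
    have : tangentCoordinates p ∘ (Metric.ball (0 : EuclideanSpace ℝ (Fin 3)) 1).domRestrict
        (fun w => leftSectionCLM (hemisphereParam p w)) = Subtype.val :=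
      funext fun w => tangentCoordinates_hemisphereParam hp w
    rw [this]
    exact Topology.IsEmbedding.subtypeVal
  · ext F
    constructor
    · rintro ⟨w, hw, rfl⟩
      rw [mem_ball_zero_iff] at hw
      refine ⟨⟨_, hemisphereParam_mem hp hw, rfl⟩, ?_⟩
      have h1 : 0 < 1 - ‖w‖ ^ 2 := by nlinarith [norm_nonneg w]
      have h2 := Real.sqrt_pos.2 h1
      rw [← inner_center_hemisphereParam hp] at h2
      exact h2
    · rintro ⟨⟨v, hv, rfl⟩, hpv⟩
      obtain ⟨w, hw, hwv⟩ := exists_hemisphereParam_eq hp hv hpv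
      refine ⟨w, mem_ball_zero_iff.2 hw, ?_⟩
      rw [← hwv]
      rfl

theorem isOrientedSubmanifold_image_leftSection :
    IsOrientedSubmanifold 3 (leftSection '' S3) sphereOrientation where
  smooth := isSmoothSubmanifold_image_leftSection
  continuous_form v := by
    simp only [sphereOrientation_apply]
    refine (Continuous.matrix_det (continuous_matrix fun i j => ?_)).continuousOn
    simp only [Matrix.of_apply]
    refine Fin.cases ?_ (fun k => ?_) j
    · exact (PiLp.continuous_apply 2 (fun _ : Fin 4 => ℝ) i).comp
        (PiLp.continuous_apply 2 (fun _ : Fin 4 => R4) 0)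
    · simp only [Fin.cons_succ]
      exact continuous_const
  ne_zero := by
    rintro _ ⟨p, hp, rfl⟩
    have h0 : (0 : EuclideanSpace ℝ (Fin 3)) ∈ Metric.ball (0 : EuclideanSpace ℝ (Fin 3)) 1 := by
      simp
    have hparam : leftSectionCLM (hemisphereParam p 0) = leftSection p := by
      simp [hemisphereParam, leftSectionCLM_apply]
    have hd := ((contDiffOn_hemisphereParam p).contDiffAt (Metric.isOpen_ball.mem_nhds h0)
      |>.differentiableAt (by simp)).hasFDerivAt
    have hle := range_fderiv_le_tangentSpaceAt Metric.isOpen_ball h0 hd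
      (V := leftSection '' S3) fun w hw =>
        ⟨_, hemisphereParam_mem hp (mem_ball_zero_iff.1 hw), rfl⟩
    rw [hparam] at hle
    set X : Fin 3 → FrameSpace := fun j =>
      fderiv ℝ (fun w => leftSectionCLM (hemisphereParam p w)) 0 (EuclideanSpace.single j 1)
    have hX : ∀ j, X j ∈ tangentSpaceAt (leftSection '' S3) (leftSection p) :=
      fun j => hle ⟨_, rfl⟩
    refine ⟨X, hX, ?_⟩
    have hon := orthonormal_iff_ite.1 (leftSection_mem_SOS3 hp).1
    have hX0 : ∀ j, X j 0 = leftSection p j.succ := fun j => by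
      refine eq_of_inner_leftSection_eq hp ?_ fun i => ?_
      · rw [(eq_leftSection_of_mem_tangentSpaceAt hp (hX j)).2]
        exact (hon 0 j.succ).symm
      · rw [← tangentCoordinates_apply, tangentCoordinates_fderiv hp h0, hon]
        simp
    rw [sphereOrientation_apply]
    have hmat : (Matrix.of fun i j =>
        (Fin.cons (leftSection p 0) (fun k => X k 0) : Fin 4 → R4) j i) =
        (Matrix.of fun i j => leftSection p i j).transpose := by
      ext i j
      refine Fin.cases ?_ (fun k => ?_) j
      · rfl
      · simp [hX0]
    rw [hmat, Matrix.det_transpose]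
    exact (leftSection_mem_SOS3 hp).2.ne'

end Chart

/-! ### The calibration argument -/

section Main

/-- Since the closure stays in M, the border is the part of the closure outside the open set O. -/
theorem isClosed_border {M U O : Set FrameSpace} (hO : IsOpen O) (hU : U = M ∩ O)
    (hUM : closure U ⊆ M) : IsClosed (closure U \ U) := by
  have : closure U \ U = closure U ∩ Oᶜ := by
    ext x
    constructor
    · rintro ⟨h1, h2⟩
      exact ⟨h1, fun hx => h2 (hU ▸ ⟨hUM h1, hx⟩)⟩
    · rintro ⟨h1, h2⟩
      exact ⟨h1, fun hx => h2 (hU ▸ hx : x ∈ M ∩ O).2⟩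
  rw [this]
  exact isClosed_closure.inter hO.isClosed_compl

theorem formIntegral_eq_of_areHomologous {V U : Set FrameSpace}
    {ηV ηU : FrameSpace → FrameSpace [⋀^Fin 3]→ₗ[ℝ] ℝ} (h : AreHomologous SOS3 V ηV U ηU) :
    formIntegral V ηV calibration = formIntegral U ηU calibration := by
  obtain ⟨n, a, c, hc, hint⟩ := h
  have := hint calibration contDiff_calibration
  rw [Finset.sum_eq_zero fun j _ => by
    rw [cubeBoundaryIntegral_calibration (hc j).1 (hc j).2, mul_zero]] at this
  exact sub_eq_zero.1 this

theorem enorm_formIntegral_le_gVolume {U O : Set FrameSpace} (hO : IsOpen O)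
    (hU : U = leftSection '' S3 ∩ O) :
    ‖formIntegral U sphereOrientation calibration‖ₑ ≤ gVolume splitMetric U sphereOrientation := by
  have hmeas : MeasurableSet U :=
    hU ▸ isCompact_image_leftSection.isClosed.measurableSet.inter hO.measurableSet
  -- This bound holds whether or not the integrand is integrable, so none of its regularity on U is
  -- needed.
  refine (enorm_integral_le_lintegral_enorm _).trans_eq ?_
  refine setLIntegral_congr_fun hmeas fun x hx => ?_
  have hx' : x ∈ leftSection '' S3 ∩ O := hU ▸ hx
  have hT : tangentSpaceAt U x = tangentSpaceAt (leftSection '' S3) x := by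
    rw [hU, tangentSpaceAt_inter_of_isOpen hO hx'.2]
  have hspec := (orthonormalFrame_spec (V := U) (η := sphereOrientation) (x := x) (by decide)
    (by rw [hT]; exact isOrientedSubmanifold_image_leftSection.ne_zero x hx'.1)).2
  generalize orthonormalFrame U sphereOrientation x = e at hspec ⊢
  rw [IsPositiveFrame, hT] at hspec
  obtain ⟨p, hp, rfl⟩ := hx'.1
  rw [calibration_eq_sqrt_det_gramMatrix hp hspec, Real.enorm_of_nonneg (Real.sqrt_nonneg _)]

theorem gVolume_le_enorm_formIntegral {V : Set FrameSpace}
    {η : FrameSpace → FrameSpace [⋀^Fin 3]→ₗ[ℝ] ℝ} (hV : IsOrientedSubmanifold 3 V η)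
    (hsp : IsSpacelike splitMetric V) (hco : IsCoherentlyOriented SOS3 splitMetric V η)
    (hcomp : IsCompact (closure V)) (hN : V ⊆ SOS3) (hfin : μHE[3] V < ⊤)
    (hmeas : MeasurableSet V) :
    gVolume splitMetric V η ≤ ‖formIntegral V η calibration‖ₑ := by
  set f : FrameSpace → ℝ := fun x => calibration x (orthonormalFrame V η x) with hf
  have hspec := fun x hx => orthonormalFrame_spec (by decide) (hV.ne_zero x hx)
  have hframe : ∀ x ∈ V, (x, orthonormalFrame V η x) ∈ spacelikeFrames 3 SOS3 splitMetric :=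
    fun x hx => ⟨hN hx, fun i => tangentSpaceAt_mono hN x ((hspec x hx).2.1 i),
      posDef_gramMatrix_splitMetric (hN hx) (tangentSpaceAt_mono hN x) (hsp x hx)
        (hspec x hx).2.1 (hspec x hx).1.linearIndependent⟩
  -- Coherent orientation gives the calibration one sign s on all of V, so no cancellation occurs in
  -- its integral.
  have hsign : ∃ s : ℝ, |s| = 1 ∧ ∀ x ∈ V, f x = s * |f x| := by
    rcases V.eq_empty_or_nonempty with rfl | ⟨x, hx⟩
    · exact ⟨1, by simp, by simp⟩
    · have hmul : ∀ y ∈ V, 0 < f x * f y := fun y hy => by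
        have h := hco x hx y hy _ _ (hspec x hx).2 (hspec y hy).2
        exact calibration_mul_pos_of_joinedIn (z := (x, orthonormalFrame V η x))
          (z' := (y, orthonormalFrame V η y)) h
      rcases lt_or_ge 0 (f x) with h | h
      · refine ⟨1, by simp, fun y hy => ?_⟩
        rw [one_mul, abs_of_pos (pos_of_mul_pos_right (hmul y hy) h.le)]
      · refine ⟨-1, by simp, fun y hy => ?_⟩
        rw [abs_of_neg (neg_of_mul_pos_right (hmul y hy) h)]
        ring
  obtain ⟨s, hs, hfs⟩ := hsign
  -- Without integrability the Bochner integral would be 0 by convention and bound nothing. It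
  -- follows from the finite area of V and the boundedness of the calibration on the compact
  -- closure.
  have hint : IntegrableOn (fun x => |f x|) V μHE[3] := by
    obtain ⟨C, hC⟩ := hcomp.exists_bound_of_continuousOn contDiff_calibration.continuous.continuousOn
    have : IsFiniteMeasure ((μHE[3] : Measure FrameSpace).restrict V) :=
      ⟨by rwa [Measure.restrict_apply_univ]⟩
    refine Integrable.of_bound
      ((continuousOn_abs_apply_orthonormalFrame (by decide) hV
        continuous_calibration_eval).aestronglyMeasurable hmeas) C ?_
    refine (ae_restrict_iff' hmeas).2 (Filter.Eventually.of_forall fun x hx => ?_)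
    rw [Real.norm_eq_abs, abs_abs, ← Real.norm_eq_abs]
    refine ((calibration x).le_opNorm _).trans ?_
    simpa [(hspec x hx).1.1] using hC x (subset_closure hx)
  have heq : formIntegral V η calibration = s * ∫ x in V, |f x| ∂μHE[3] := by
    rw [← integral_const_mul]
    exact setIntegral_congr_fun hmeas hfs
  have hnonneg : 0 ≤ ∫ x in V, |f x| ∂μHE[3] := integral_nonneg fun x => abs_nonneg _
  rw [heq, enorm_mul, ← Real.enorm_abs s, hs, enorm_one, one_mul, Real.enorm_of_nonneg hnonneg,
    ofReal_integral_eq_lintegral_ofReal hint (Filter.Eventually.of_forall fun x => abs_nonneg _)]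
  exact setLIntegral_mono' hmeas fun x hx =>
    ENNReal.ofReal_le_ofReal (sqrt_det_gramMatrix_le (hframe x hx)).1

theorem homologicallyVolumeMaximizing_image_leftSection :
    HomologicallyVolumeMaximizing SOS3 splitMetric (leftSection '' S3) sphereOrientation := by
  rintro U ⟨O, hO, hU⟩ - hUM - V η hV hsp hco hcomp hN hfin hborder hhom
  -- V is its closure minus its border, and that border is the one of U, which is closed.
  have hmeas : MeasurableSet V := by
    have h : V = closure V \ (closure V \ V) := by
      rw [Set.sdiff_sdiff_cancel_left subset_closure]
    rw [h, hborder]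
    exact isClosed_closure.measurableSet.diff (isClosed_border hO hU hUM).measurableSet
  calc gVolume splitMetric V η ≤ ‖formIntegral V η calibration‖ₑ :=
        gVolume_le_enorm_formIntegral hV hsp hco hcomp (subset_closure.trans hN) hfin hmeas
    _ = ‖formIntegral U sphereOrientation calibration‖ₑ := by
        rw [formIntegral_eq_of_areHomologous hhom]
    _ ≤ gVolume splitMetric U sphereOrientation := enorm_formIntegral_le_gVolume hO hU

end Main

end

theorem mainTheorem3 :
    (∀ p ∈ S3, leftSection p ∈ SOS3 ∧ leftSection p 0 = p) ∧
    ContDiff ℝ ∞ leftSection ∧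
    IsOrientedSubmanifold 3 (leftSection '' S3) sphereOrientation ∧
    IsSpacelike splitMetric (leftSection '' S3) ∧
    HomologicallyVolumeMaximizing SOS3 splitMetric (leftSection '' S3) sphereOrientation :=
  ⟨fun p hp => ⟨leftSection_mem_SOS3 hp, leftSection_zero p⟩, contDiff_leftSection,
    isOrientedSubmanifold_image_leftSection, isSpacelike_image_leftSection,
    homologicallyVolumeMaximizing_image_leftSection⟩
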